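/- **Setting.** Let $V$ be a finite-dimensional real vector space, $(\alpha_i)_{i\in I}$ a finite linearly independent family in $V^*$ and $(\alpha_i^\vee)_{i\in I}$ a family in $V$ with $\alpha_i(\alpha_i^\vee)=2$; put $r_i(v)=v-\alpha_i(v)\alpha_i^\vee$, $W^v=\langle r_i\mid i\in I\rangle\subset GL(V)$ (acting on $V^*$ by $w\alpha=\alpha\circ w^{-1}$) and $\Phi=\{w\alpha_i\mid w\in W^v,\ i\in I\}$ (the real roots). Assume that $(W^v,(r_i))$ is a Coxeter system with length $\ell$; that for $\alpha=w\alpha_i\in\Phi$ the reflection $r_\alpha=wr_iw^{-1}$ depends only on $\alpha$; that every root in $\Phi$ is positive, i.e. in $Q_+=\sum_i\mathbb R_{\ge0}\alpha_i$, or negative, i.e. in $-Q_+$; that $w\alpha_i\in Q_+\Leftrightarrow \ell(wr_i)>\ell(w)$; and that $\Phi\cap\mathbb R_{>0}\alpha=\{\alpha\}$ for $\alpha\in\Phi$. Let $\Delta_{im}\subset V^*$ (imaginary roots) be disjoint from $\mathbb R\Phi$ and stable under $\pm W^v$, and moderately imaginary: $\Delta_{im}\subset Q_+\cup -Q_+$,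 and $\Delta_{im}\cap Q_+$ is stable under $W^v$. Put $\Delta=\Phi\cup\Delta_{im}$. For $J\subset I$ let $F^v(J)=\{v\mid \alpha_i(v)=0\ (i\in J),\ \alpha_i(v)>0\ (i\notin J)\}$. The vectorial facets are the sets $\pm wF^v(J)$ with $w\in W^v$; such a facet is spherical if $\langle r_i\mid i\in J\rangle$ is finite. The Tits cone is $\mathcal T=\bigcup_{w,J}wF^v(J)$, and $\mathcal T^\circ$ is its interior. Let $\mathbb A$ be an affine space under $V$ with a set $\mathcal M$ of affine hyperplanes (walls), each with direction $\ker\alpha$ for some $\alpha\in\Phi$, such that for each $\alpha\in\Phi$ infinitely many walls have direction $\ker\alpha$, and such that $\mathcal M$ is stable under the group $W$ generated by the affine reflections $r_M$ ($M\in\mathcal M$) with hyperplane $M$ and linear part $r_\alpha$, where $\ker\alpha$ is the direction of $M$. For $p,q\in\mathbb A$ write $p\le q$ if $q-p\in\mathcal T$ and $p\mathrel{\overset{\circ}{\le}}q$ if $q-p\in\mathcal T^\circ\cup\{0\}$. Subsets of a set are identified with the filters that they generate; a set (or filter) contains a filter $F$ if it belongs to $F$ (resp. all its elements do). The union $F\cup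 F'$ of two filters consists of the sets belonging to both. A map fixes a filter if it fixes pointwise some element of it. For $\alpha\in\Delta$, an $\alpha$-half-space is $\mathbb A$ or a half-space $\{a\mid\alpha(a-p)\ge0\}$, where $p\in\mathbb A$ and, if $\alpha\in\Phi$, $p+\ker\alpha\in\mathcal M$; open $\alpha$-half-spaces are $\mathbb A$ and the sets obtained with $>$ instead of $\ge$. The enclosure $cl(F)$ of a filter $F$ consists of the sets containing an element of $F$ that is an intersection of $\alpha$-half-spaces, one for each $\alpha\in\Delta$. The facet $F(x,F^v)$, for $x\in\mathbb A$ and a vectorial facet $F^v$, consists of the sets containing an intersection of closed or open $\alpha$-half-spaces, one for each $\alpha\in\Delta$, that contains a neighbourhood of $x$ in $x+F^v$. The chimney with base a facet $F$ and direction a vectorial facet $F^v$ is $cl(F+F^v)$; its germ consists of the sets containing $cl(F+\xi+F^v)$ for some $\xi\in\overline{F^v}$. The chimney is splayed if $F^v$ is spherical, and solid if the direction of its support (the smallest affine subspace containing it) has a finite pointwise fixer in $W^v$. For $p\ne q$, the germ at $p$ of the interval $]p,q]$ is preordered if $p\le q$ or $q\le p$, and the half-line from $p$ through $q$ is generic if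 $p\mathrel{\overset{\circ}{\le}}q$ or $q\mathrel{\overset{\circ}{\le}}p$. An apartment of type $\mathbb A$ is a set $A$ with a nonempty set of bijections $\mathbb A\to A$ that is of the form $f_0\circ W$ for each of its elements $f_0$; an isomorphism $A\to A'$ is a bijection carrying such bijections for $A$ to such bijections for $A'$. All the notions above are invariant under $W$, so they make sense in $A$; an index $A$ marks them. An affine hovel of type $\mathbb A$ is a set $\mathcal I$ covered by a set of subsets, called apartments, such that: (MA1) each apartment has a structure of apartment of type $\mathbb A$; (MA2) if $F$ is a point, a germ of preordered interval, a generic half-line or a solid chimney of an apartment $A$, and $A'$ is an apartment containing $F$, then $A\cap A'$ contains $cl_A(F)$ and some isomorphism $A\to A'$ fixes $cl_A(F)$; (MA3) if $\mathfrak R$ is a germ of a splayed chimney (of some apartment) and $F$ a facet or a germ of a solid chimney (of some apartment), then some apartment contains $\mathfrak R$ and $F$; (MA4) if two apartments $A,A'$ contain $\mathfrak R$ and $F$ as in (MA3), then $A\cap A'$ contains $cl_A(\mathfrak R\cup F)$ and some isomorphism $A\to A'$ fixes $cl_A(\mathfrak R\cup F)$. It is ordered if moreover (MAO) for all $x,y\in\mathcal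 I$ and apartments $A,A'$ containing both, $x\le_Ay$ implies $[x,y]_A=[x,y]_{A'}$. **Statement.** Let $\mathcal I$ be an ordered affine hovel of type $\mathbb A$. Let $A_1,A_2$ be apartments and $x\neq y$ two points of $A_1\cap A_2$ with $x\le_{A_1}y$ (respectively $x\mathrel{\overset{\circ}{\le}}_{A_1}y$). Then $x\le_{A_2}y$ (respectively $x\mathrel{\overset{\circ}{\le}}_{A_2}y$), and there is an isomorphism $A_1\to A_2$ which fixes the enclosure $cl_{A_1}([x,y]_{A_1})$. Consequently the relations $\le$ and $\overset{\circ}{\le}$ on $\mathcal I$, where $x\le y$ (respectively $x\mathrel{\overset{\circ}{\le}}y$) means that $x\le_Ay$ (respectively $x\mathrel{\overset{\circ}{\le}}_Ay$) for some apartment $A$ containing $x$ and $y$, are well defined: for every apartment $A$ and all $x,y\in A$ one has $x\le y\Leftrightarrow x\le_Ay$ and $x\mathrel{\overset{\circ}{\le}}y\Leftrightarrow x\mathrel{\overset{\circ}{\le}}_Ay$. -/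

import Mathlib

open Set Filter Topology Module

noncomputable section

namespace Hovel

/-- A finite family of simple roots and coroots in a real vector space. -/
structure SimpleRoots (V I : Type*) [AddCommGroup V] [Module ℝ V] where
  /-- the simple roots `α i` -/
  root : I → Dual ℝ V
  /-- the simple coroots -/
  coroot : I → V
  root_independent : LinearIndependent ℝ root
  root_coroot_two : ∀ i, root i (coroot i) = 2

namespace SimpleRoots

variable {V I : Type*} [AddCommGroup V] [Module ℝ V] (R : SimpleRoots V I)

/-- The simple reflection `v ↦ v - α i (v) • αᵛ i`. -/
def simpleReflection (i : I) : V ≃ₗ[ℝ] V := Module.reflection (R.root_coroot_two i)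

/-- The subgroup `Wᵛ(J)` generated by the simple reflections with index in `J`. -/
def parabolic (J : Set I) : Subgroup (V ≃ₗ[ℝ] V) :=
  Subgroup.closure (R.simpleReflection '' J)

/-- The vectorial Weyl group `Wᵛ`. -/
def vectorialWeyl : Subgroup (V ≃ₗ[ℝ] V) :=
  Subgroup.closure (Set.range R.simpleReflection)

/-- A simple reflection, as an element of the vectorial Weyl group. -/
def simpleReflectionW (i : I) : R.vectorialWeyl :=
  ⟨R.simpleReflection i, Subgroup.subset_closure (Set.mem_range_self i)⟩

/-- The real roots: the forms `w (α i)`, with `w` in `Wᵛ`. -/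
def realRoots : Set (Dual ℝ V) :=
  {α | ∃ w ∈ R.vectorialWeyl, ∃ i, α = R.root i ∘ₗ (w.symm : V →ₗ[ℝ] V)}

/-- The cone of linear combinations of the simple roots with nonnegative coefficients. -/
def positiveCone [Fintype I] : Set (Dual ℝ V) :=
  {β | ∃ c : I → ℝ, (∀ i, 0 ≤ c i) ∧ β = ∑ i, c i • R.root i}

/-- The face `Fᵛ(J)` of the fundamental chamber: `α i = 0` for `i` in `J` and `α i > 0`
for the other `i`. -/
def stdFacet (J : Set I) : Set V :=
  {v | (∀ i ∈ J, R.root i v = 0) ∧ ∀ i ∉ J, 0 < R.root i v}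

/-- Vectorial facets, positive (`w Fᵛ(J)`) or negative (`- w Fᵛ(J)`). -/
def IsVectorialFacet (F : Set V) : Prop :=
  ∃ w ∈ R.vectorialWeyl, ∃ J : Set I,
    F = w '' R.stdFacet J ∨ F = (fun v => -w v) '' R.stdFacet J

/-- Spherical vectorial facets: those of type `J` with `Wᵛ(J)` finite. -/
def IsSphericalFacet (F : Set V) : Prop :=
  ∃ w ∈ R.vectorialWeyl, ∃ J : Set I, Finite (R.parabolic J) ∧
    (F = w '' R.stdFacet J ∨ F = (fun v => -w v) '' R.stdFacet J)

/-- The Tits cone: the union of the positive vectorial facets. -/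
def titsCone : Set V :=
  {v | ∃ w ∈ R.vectorialWeyl, ∃ J : Set I, v ∈ w '' R.stdFacet J}

end SimpleRoots

/-- The vectorial data: simple roots and coroots whose reflections generate a Coxeter group
`Wᵛ`, such that every real root is positive or negative, together with a set of imaginary
roots. -/
structure VectorialDatum (V I : Type*) [AddCommGroup V] [Module ℝ V] [Fintype I] extends
    SimpleRoots V I where
  /-- the Coxeter matrix of `Wᵛ` -/
  coxeterMatrix : CoxeterMatrix I
  /-- `Wᵛ` is a Coxeter group on the simple reflections -/
  coxeterSystem : CoxeterSystem coxeterMatrix toSimpleRoots.vectorialWeyl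
  coxeter_simple : ∀ i, coxeterSystem.simple i = toSimpleRoots.simpleReflectionW i
  /-- the reflection `w rᵢ w⁻¹` depends only on the root `w (α i)` -/
  reflection_wellDefined : ∀ w ∈ toSimpleRoots.vectorialWeyl,
    ∀ w' ∈ toSimpleRoots.vectorialWeyl, ∀ i j,
      root i ∘ₗ (w.symm : V →ₗ[ℝ] V) = root j ∘ₗ (w'.symm : V →ₗ[ℝ] V) →
      w * toSimpleRoots.simpleReflection i * w⁻¹ =
        w' * toSimpleRoots.simpleReflection j * w'⁻¹
  /-- every real root is positive or negative -/
  pos_or_neg : ∀ α ∈ toSimpleRoots.realRoots,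
    α ∈ toSimpleRoots.positiveCone ∨ -α ∈ toSimpleRoots.positiveCone
  /-- `w (α i)` is positive if and only if `w rᵢ` is longer than `w` -/
  pos_iff_length : ∀ (w : toSimpleRoots.vectorialWeyl) (i : I),
    root i ∘ₗ ((w : V ≃ₗ[ℝ] V).symm : V →ₗ[ℝ] V) ∈ toSimpleRoots.positiveCone ↔
      coxeterSystem.length w <
        coxeterSystem.length (w * toSimpleRoots.simpleReflectionW i)
  /-- the only positive multiple of a real root that is a real root is the root itself -/
  reduced : ∀ α ∈ toSimpleRoots.realRoots, ∀ c : ℝ, 0 < c →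
    c • α ∈ toSimpleRoots.realRoots → c = 1
  /-- the imaginary roots -/
  imRoots : Set (Dual ℝ V)
  imRoots_disjoint : ∀ β ∈ imRoots, ∀ α ∈ toSimpleRoots.realRoots, ∀ c : ℝ, β ≠ c • α
  imRoots_neg : ∀ β ∈ imRoots, -β ∈ imRoots
  imRoots_weyl : ∀ w ∈ toSimpleRoots.vectorialWeyl, ∀ β ∈ imRoots,
    β ∘ₗ (w.symm : V →ₗ[ℝ] V) ∈ imRoots

namespace VectorialDatum

variable {V I : Type*} [AddCommGroup V] [Module ℝ V] [Fintype I] (D : VectorialDatum V I)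

/-- All roots, real or imaginary. -/
def roots : Set (Dual ℝ V) := D.realRoots ∪ D.imRoots

/-- The moderately imaginary case: every imaginary root is positive or negative, and the set of
positive imaginary roots is stable under `Wᵛ`. -/
def ModeratelyImaginary : Prop :=
  (∀ β ∈ D.imRoots, β ∈ D.positiveCone ∨ -β ∈ D.positiveCone) ∧
  ∀ w ∈ D.vectorialWeyl, ∀ β ∈ D.imRoots, β ∈ D.positiveCone →
    β ∘ₗ (w.symm : V →ₗ[ℝ] V) ∈ D.positiveCone

end VectorialDatum

/-- The affine reflections `r_M`: the reflection with hyperplane `M` whose linear part is `r_α`,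
for a hyperplane `M` in `walls` and a real root `α` such that `M` has direction `ker α`. -/
def wallReflections {V 𝔸 I : Type*} [AddCommGroup V] [Module ℝ V] [AddTorsor V 𝔸]
    (R : SimpleRoots V I) (walls : Set (AffineSubspace ℝ 𝔸)) : Set (𝔸 ≃ᵃ[ℝ] 𝔸) :=
  {g | ∃ M ∈ walls, ∃ w ∈ R.vectorialWeyl, ∃ i,
    M.direction = LinearMap.ker (R.root i ∘ₗ (w.symm : V →ₗ[ℝ] V)) ∧
    g.linear = w * R.simpleReflection i * w⁻¹ ∧ ∀ p ∈ M, g p = p}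

/-- The model apartment: an affine space `𝔸` under `V` with a set of (real) walls. -/
structure ModelApartment (V 𝔸 I : Type*) [AddCommGroup V] [Module ℝ V] [AddTorsor V 𝔸]
    [Fintype I] extends VectorialDatum V I where
  /-- the real walls -/
  walls : Set (AffineSubspace ℝ 𝔸)
  wall_nonempty : ∀ M ∈ walls, (M : Set 𝔸).Nonempty
  wall_direction : ∀ M ∈ walls, ∃ α ∈ toSimpleRoots.realRoots, M.direction = LinearMap.ker α
  infinite_walls : ∀ α ∈ toSimpleRoots.realRoots,
    {M ∈ walls | M.direction = LinearMap.ker α}.Infinite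
  walls_stable : ∀ g ∈ Subgroup.closure (wallReflections toSimpleRoots walls),
    ∀ M ∈ walls, M.map (g : 𝔸 →ᵃ[ℝ] 𝔸) ∈ walls

namespace ModelApartment

variable {V 𝔸 I : Type*} [NormedAddCommGroup V] [NormedSpace ℝ V] [MetricSpace 𝔸]
  [NormedAddTorsor V 𝔸] [Fintype I] (D : ModelApartment V 𝔸 I)

/-- The affine Weyl group `W`. -/
def weyl : Subgroup (𝔸 ≃ᵃ[ℝ] 𝔸) :=
  Subgroup.closure (wallReflections D.toSimpleRoots D.walls)

/-- The hyperplane through `p` with direction `ker α` is a wall, real if `α` is a real root and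
imaginary if `α` is an imaginary root (every such hyperplane is then an imaginary wall). -/
def IsWallAt (α : Dual ℝ V) (p : 𝔸) : Prop :=
  (α ∈ D.realRoots ∧ AffineSubspace.mk' p (LinearMap.ker α) ∈ D.walls) ∨ α ∈ D.imRoots

/-- The sets `D(α, k)`: closed half-spaces bounded by a wall, or the whole of `𝔸`. -/
def IsHalfSpace (α : Dual ℝ V) (H : Set 𝔸) : Prop :=
  H = univ ∨ ∃ p, D.IsWallAt α p ∧ H = {a | 0 ≤ α (a -ᵥ p)}

/-- The sets `D°(α, k)`: open half-spaces bounded by a wall, or the whole of `𝔸`. -/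
def IsOpenHalfSpace (α : Dual ℝ V) (H : Set 𝔸) : Prop :=
  H = univ ∨ ∃ p, D.IsWallAt α p ∧ H = {a | 0 < α (a -ᵥ p)}

/-- Intersections over all roots `α` of closed half-spaces `D(α, k_α)`. -/
def IsClosedCell (E : Set 𝔸) : Prop :=
  ∃ H : Dual ℝ V → Set 𝔸, (∀ α ∈ D.roots, D.IsHalfSpace α (H α)) ∧ E = ⋂ α ∈ D.roots, H α

/-- Intersections over all roots `α` of half-spaces `D(α, k_α)` or `D°(α, k_α)`. -/
def IsCell (E : Set 𝔸) : Prop :=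
  ∃ H : Dual ℝ V → Set 𝔸,
    (∀ α ∈ D.roots, D.IsHalfSpace α (H α) ∨ D.IsOpenHalfSpace α (H α)) ∧
    E = ⋂ α ∈ D.roots, H α

variable {D} in
theorem halfSpace_total {α : Dual ℝ V} {H H' : Set 𝔸}
    (h : D.IsHalfSpace α H ∨ D.IsOpenHalfSpace α H)
    (h' : D.IsHalfSpace α H' ∨ D.IsOpenHalfSpace α H') : H ⊆ H' ∨ H' ⊆ H := by
  have key : ∀ p q a : 𝔸, α (a -ᵥ p) = α (a -ᵥ q) + α (q -ᵥ p) := fun p q a => by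
    rw [← map_add, vsub_add_vsub_cancel]
  rcases h with (rfl | ⟨p, -, rfl⟩) | (rfl | ⟨p, -, rfl⟩)
  · exact Or.inr (subset_univ _)
  all_goals try exact Or.inr (subset_univ _)
  all_goals
    rcases h' with (rfl | ⟨q, -, rfl⟩) | (rfl | ⟨q, -, rfl⟩)
    all_goals try exact Or.inl (subset_univ _)
    all_goals
      by_contra! hc
      obtain ⟨⟨a, ha, ha'⟩, b, hb, hb'⟩ := (And.imp not_subset.1 not_subset.1 hc)
      have h1 := key p q a
      have h2 := key p q b
      simp only [mem_ofPred_eq, not_le, not_lt] at ha ha' hb hb'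
      linarith

variable {D} in
theorem IsClosedCell.inter {E E' : Set 𝔸} (h : D.IsClosedCell E) (h' : D.IsClosedCell E') :
    D.IsClosedCell (E ∩ E') := by
  obtain ⟨H, hH, rfl⟩ := h
  obtain ⟨H', hH', rfl⟩ := h'
  refine ⟨fun α => H α ∩ H' α, fun α hα => ?_, ?_⟩
  · rcases halfSpace_total (Or.inl (hH α hα)) (Or.inl (hH' α hα)) with h | h
    · simpa only [inter_eq_left.2 h] using hH α hα
    · simpa only [inter_eq_right.2 h] using hH' α hα
  · simp only [iInter_inter_distrib]

variable {D} in
theorem IsCell.inter {E E' : Set 𝔸} (h : D.IsCell E) (h' : D.IsCell E') :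
    D.IsCell (E ∩ E') := by
  obtain ⟨H, hH, rfl⟩ := h
  obtain ⟨H', hH', rfl⟩ := h'
  refine ⟨fun α => H α ∩ H' α, fun α hα => ?_, ?_⟩
  · rcases halfSpace_total (hH α hα) (hH' α hα) with h | h
    · simpa only [inter_eq_left.2 h] using hH α hα
    · simpa only [inter_eq_right.2 h] using hH' α hα
  · simp only [iInter_inter_distrib]

theorem isClosedCell_univ : D.IsClosedCell univ :=
  ⟨fun _ => univ, fun _ _ => Or.inl rfl, by simp⟩

theorem isCell_univ : D.IsCell univ :=
  ⟨fun _ => univ, fun _ _ => Or.inl (Or.inl rfl), by simp⟩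

/-- The enclosure `cl(F)` of a filter `F`: the sets that contain an element of `F` of the form
`⋂ α, D(α, k_α)`. A filter `F` is contained in a filter `G` when `F ≤ G`, and a set is identified
with the principal filter that it generates. -/
def enclosure (F : Filter 𝔸) : Filter 𝔸 where
  sets := {S | ∃ E ∈ F, D.IsClosedCell E ∧ E ⊆ S}
  univ_sets := ⟨univ, univ_mem, D.isClosedCell_univ, Subset.rfl⟩
  sets_of_superset := fun ⟨E, hE, hc, hs⟩ h => ⟨E, hE, hc, hs.trans h⟩
  inter_sets := fun ⟨E, hE, hc, hs⟩ ⟨E', hE', hc', hs'⟩ =>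
    ⟨E ∩ E', inter_mem hE hE', hc.inter hc', inter_subset_inter hs hs'⟩

/-- The facet `F(x, Fᵛ)`: the sets that contain an intersection of closed or open half-spaces,
one for each root, that contains the local facet `germ_x (x + Fᵛ)`. -/
def facet (x : 𝔸) (Fv : Set V) : Filter 𝔸 where
  sets := {S | ∃ E ∈ 𝓝[(fun v => v +ᵥ x) '' Fv] x, D.IsCell E ∧ E ⊆ S}
  univ_sets := ⟨univ, univ_mem, D.isCell_univ, Subset.rfl⟩
  sets_of_superset := fun ⟨E, hE, hc, hs⟩ h => ⟨E, hE, hc, hs.trans h⟩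
  inter_sets := fun ⟨E, hE, hc, hs⟩ ⟨E', hE', hc', hs'⟩ =>
    ⟨E ∩ E', inter_mem hE hE', hc.inter hc', inter_subset_inter hs hs'⟩

/-- The chimney `cl(F + Fᵛ)` with base `F` and direction `Fᵛ`. -/
def chimney (F : Filter 𝔸) (Fv : Set V) : Filter 𝔸 :=
  D.enclosure (Filter.map₂ (fun v a => v +ᵥ a) (𝓟 Fv) F)

/-- The germ of a chimney: the sets that contain one of its shortenings `cl(F + ξ + Fᵛ)`, for
`ξ` in the closure of `Fᵛ` (these shortenings form a directed family). -/
def chimneyGerm (F : Filter 𝔸) (Fv : Set V) : Filter 𝔸 :=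
  ⨅ ξ ∈ closure Fv, D.chimney (Filter.map (fun a => ξ +ᵥ a) F) Fv

/-- The support of a filter: the smallest affine subspace that contains it. -/
def support (F : Filter 𝔸) : AffineSubspace ℝ 𝔸 :=
  sInf {E : AffineSubspace ℝ 𝔸 | (E : Set 𝔸) ∈ F}

/-- A filter is solid if the direction of its support has a finite pointwise fixer in `Wᵛ`. -/
def IsSolid (F : Filter 𝔸) : Prop :=
  {w | w ∈ D.vectorialWeyl ∧ ∀ v ∈ (support F).direction, w v = v}.Finite

/-- The facets of `𝔸`. -/
def IsFacet (F : Filter 𝔸) : Prop :=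
  ∃ x Fv, D.IsVectorialFacet Fv ∧ F = D.facet x Fv

/-- The solid chimneys of `𝔸`. -/
def IsSolidChimney (F : Filter 𝔸) : Prop :=
  ∃ B Fv, D.IsFacet B ∧ D.IsVectorialFacet Fv ∧ D.IsSolid (D.chimney B Fv) ∧ F = D.chimney B Fv

/-- The germs of solid chimneys of `𝔸`. -/
def IsSolidChimneyGerm (F : Filter 𝔸) : Prop :=
  ∃ B Fv, D.IsFacet B ∧ D.IsVectorialFacet Fv ∧ D.IsSolid (D.chimney B Fv) ∧
    F = D.chimneyGerm B Fv

/-- The germs of splayed chimneys of `𝔸`: those with a spherical direction. -/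
def IsSplayedChimneyGerm (F : Filter 𝔸) : Prop :=
  ∃ B Fv, D.IsFacet B ∧ D.IsSphericalFacet Fv ∧ F = D.chimneyGerm B Fv

/-- The preorder `p ≤ q` on `𝔸`. -/
def Le (p q : 𝔸) : Prop := q -ᵥ p ∈ D.titsCone

/-- The preorder `p ≤° q` on `𝔸`. -/
def OpenLe (p q : 𝔸) : Prop := q -ᵥ p ∈ interior D.titsCone ∪ {0}

/-- The germs at `p` of preordered intervals `]p, q]`. -/
def IsPreorderedIntervalGerm (F : Filter 𝔸) : Prop :=
  ∃ p q, p ≠ q ∧ (D.Le p q ∨ D.Le q p) ∧ F = 𝓝[affineSegment ℝ p q \ {p}] p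

/-- The generic half-lines, with origin `p` and containing `q`. -/
def IsGenericRay (F : Filter 𝔸) : Prop :=
  ∃ p q, p ≠ q ∧ (D.OpenLe p q ∨ D.OpenLe q p) ∧
    F = 𝓟 {a | ∃ t : ℝ, 0 ≤ t ∧ a = t • (q -ᵥ p) +ᵥ p}

end ModelApartment

/-- A set covered by subsets called apartments, each with a structure of apartment of type `𝔸`:
a nonempty set of bijections from `𝔸`, which is an orbit under composition with `W`. -/
structure ApartmentSystem {V 𝔸 I : Type*} [NormedAddCommGroup V] [NormedSpace ℝ V]
    [MetricSpace 𝔸] [NormedAddTorsor V 𝔸] [Fintype I] (D : ModelApartment V 𝔸 I)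
    (X : Type*) where
  apartments : Set (Set X)
  cover : ∀ z, ∃ A ∈ apartments, z ∈ A
  /-- the isomorphisms from `𝔸` to an apartment -/
  isom : (A : Set X) → Set (𝔸 ≃ A)
  isom_nonempty : ∀ A ∈ apartments, (isom A).Nonempty
  mem_isom_iff : ∀ A ∈ apartments, ∀ f₀ ∈ isom A, ∀ f : 𝔸 ≃ A,
    f ∈ isom A ↔ ∃ w ∈ D.weyl, f = w.toEquiv.trans f₀

namespace ApartmentSystem

variable {V 𝔸 I X : Type*} [NormedAddCommGroup V] [NormedSpace ℝ V]
  [MetricSpace 𝔸] [NormedAddTorsor V 𝔸] [Fintype I] {D : ModelApartment V 𝔸 I}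
  (H : ApartmentSystem D X)

/-- The isomorphisms between two apartments. -/
def IsIso (A A' : Set X) (φ : A ≃ A') : Prop :=
  ∃ f ∈ H.isom A, f.trans φ ∈ H.isom A'

/-- The map `φ` fixes the filter `G`, i.e. it fixes pointwise an element of `G`. -/
def Fixes {A A' : Set X} (φ : A ≃ A') (G : Filter X) : Prop :=
  {z | ∃ h : z ∈ A, (φ ⟨z, h⟩ : X) = z} ∈ G

/-- The filter `G` on `X` is, in the apartment `A`, an object of the kind `P`. -/
def IsIn (P : Filter 𝔸 → Prop) (A : Set X) (G : Filter X) : Prop :=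
  ∃ f ∈ H.isom A, ∃ F, P F ∧ G = Filter.map (fun p => (f p : X)) F

/-- The enclosure `cl_A(G)`, computed in an isomorphism `𝔸 → A`. The result is the same for all
these isomorphisms, since they differ by elements of `W`. -/
def enclosure (A : Set X) (G : Filter X) : Filter X :=
  ⨆ f ∈ H.isom A, Filter.map (fun p => (f p : X))
    (D.enclosure (Filter.comap (fun p => (f p : X)) G))

/-- The relation `x ≤_A y`. -/
def LeIn (A : Set X) (x y : X) : Prop :=
  ∃ f ∈ H.isom A, ∃ p q, (f p : X) = x ∧ (f q : X) = y ∧ D.Le p q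

/-- The relation `x ≤°_A y`. -/
def OpenLeIn (A : Set X) (x y : X) : Prop :=
  ∃ f ∈ H.isom A, ∃ p q, (f p : X) = x ∧ (f q : X) = y ∧ D.OpenLe p q

/-- The segment `[x, y]_A`. -/
def segmentIn (A : Set X) (x y : X) : Set X :=
  {z | ∃ f ∈ H.isom A, ∃ p q, (f p : X) = x ∧ (f q : X) = y ∧
    ∃ m ∈ affineSegment ℝ p q, (f m : X) = z}

/-- The relation `x ≤ y` on `X`: it holds in some apartment. -/
def Le (x y : X) : Prop := ∃ A ∈ H.apartments, H.LeIn A x y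

/-- The relation `x ≤° y` on `X`: it holds in some apartment. -/
def OpenLe (x y : X) : Prop := ∃ A ∈ H.apartments, H.OpenLeIn A x y

/-- The axioms of affine hovels (besides the apartment structures). A filter on `X` is contained
in `A` when `A` belongs to it. -/
structure IsAffineHovel : Prop where
  MA2 : ∀ A ∈ H.apartments, ∀ G : Filter X,
    ((∃ x ∈ A, G = 𝓟 {x}) ∨ H.IsIn D.IsPreorderedIntervalGerm A G ∨
      H.IsIn D.IsGenericRay A G ∨ H.IsIn D.IsSolidChimney A G) →
    ∀ A' ∈ H.apartments, A' ∈ G →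
      A ∩ A' ∈ H.enclosure A G ∧ ∃ φ : A ≃ A', H.IsIso A A' φ ∧ Fixes φ (H.enclosure A G)
  MA3 : ∀ B ∈ H.apartments, ∀ B' ∈ H.apartments, ∀ R F : Filter X,
    H.IsIn D.IsSplayedChimneyGerm B R →
    (H.IsIn D.IsFacet B' F ∨ H.IsIn D.IsSolidChimneyGerm B' F) →
    ∃ A ∈ H.apartments, A ∈ R ∧ A ∈ F
  MA4 : ∀ B ∈ H.apartments, ∀ B' ∈ H.apartments, ∀ R F : Filter X,
    H.IsIn D.IsSplayedChimneyGerm B R →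
    (H.IsIn D.IsFacet B' F ∨ H.IsIn D.IsSolidChimneyGerm B' F) →
    ∀ A ∈ H.apartments, ∀ A' ∈ H.apartments, A ∈ R → A ∈ F → A' ∈ R → A' ∈ F →
      A ∩ A' ∈ H.enclosure A (R ⊔ F) ∧
      ∃ φ : A ≃ A', H.IsIso A A' φ ∧ Fixes φ (H.enclosure A (R ⊔ F))

/-- The axiom (MAO) of ordered hovels. -/
def IsOrdered : Prop :=
  ∀ x y, ∀ A ∈ H.apartments, ∀ A' ∈ H.apartments, x ∈ A → y ∈ A → x ∈ A' → y ∈ A' →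
    H.LeIn A x y → H.segmentIn A x y = H.segmentIn A' x y

end ApartmentSystem

end Hovel

end

/-! Isomorphisms from `𝔸` to apartments are handled as charts, i.e. maps `𝔸 → X`. Let `f`, `h` be
charts whose images contain `f p` and `f q`, with `p ≤ q`. It suffices to find a chart of the
apartment of `h` that agrees with `f` on a closed cell containing `p` and `q`: closed cells are
convex, so this cell belongs to the enclosure of the segment. A change of chart by `W` makes `q - p`
dominant, i.e. nonnegative on all simple roots. Let `C` be the fundamental chamber and `u` a vector
on which every simple root is 1.

Two tools carry the proof. Since every root is positive or negative, a closed cell containing `a`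
and `b` contains the whole box between them (`IsClosedCell.mem_of_between`), and one containing a
sector germ is stable under the closed cone of that sector. A chart is determined, among those of
its apartment, by its values on a box from `a` to `a + εu`. Secondly, (MAO) and (MA2) make two
charts agree along a preordered segment as soon as they agree at its origin and at one further
point, and the other end lies in both apartments (`eq_on_segment`). The reason is that no element of
`Wᵛ` dilates a nonzero vector of the Tits cone.

The main difficulty is that (MA3) yields an apartment containing the sector germ of `f` in direction
`C` and that of `h` in direction `-C`, but says nothing about `x`. When `f` and `h` agree near `x`
in direction `-C`, a continuity argument along the ray `x - tu` (`Linked`) shows that such an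
apartment does contain `x`. The sectors with apex `x` in directions `C` and `-C` then lie in one
chart, which gives agreement on a cell containing `x` and a point `y` above it
(`exists_closedCell_of_opposite`). The general dominant case reduces to this one through an
auxiliary apartment. -/

namespace Hovel

/-! ### Roots, dominant vectors and the Tits cone. -/

namespace VectorialDatum

variable {V I : Type*} [AddCommGroup V] [Module ℝ V] [Fintype I] (D : VectorialDatum V I)

theorem nonneg_of_mem_positiveCone {β : Dual ℝ V} (hβ : β ∈ D.positiveCone) {v : V}
    (hv : ∀ i, 0 ≤ D.root i v) : 0 ≤ β v := by
  obtain ⟨c, hc, rfl⟩ := hβ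
  simp only [LinearMap.sum_apply, LinearMap.smul_apply, smul_eq_mul]
  exact Finset.sum_nonneg fun i _ => mul_nonneg (hc i) (hv i)

theorem root_pos_or_neg (hD : D.ModeratelyImaginary) {α : Dual ℝ V} (hα : α ∈ D.roots) :
    α ∈ D.positiveCone ∨ -α ∈ D.positiveCone :=
  hα.elim (D.pos_or_neg α) (hD.1 α)

theorem comp_mem_realRoots {w : V ≃ₗ[ℝ] V} (hw : w ∈ D.vectorialWeyl) {α : Dual ℝ V}
    (hα : α ∈ D.realRoots) : α ∘ₗ (w : V →ₗ[ℝ] V) ∈ D.realRoots := by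
  obtain ⟨w', hw', i, rfl⟩ := hα
  refine ⟨w⁻¹ * w', mul_mem (inv_mem hw) hw', i, ?_⟩
  ext v
  rfl

theorem comp_mem_imRoots {w : V ≃ₗ[ℝ] V} (hw : w ∈ D.vectorialWeyl) {α : Dual ℝ V}
    (hα : α ∈ D.imRoots) : α ∘ₗ (w : V →ₗ[ℝ] V) ∈ D.imRoots :=
  D.imRoots_weyl w⁻¹ (inv_mem hw) α hα

theorem comp_mem_roots {w : V ≃ₗ[ℝ] V} (hw : w ∈ D.vectorialWeyl) {α : Dual ℝ V}
    (hα : α ∈ D.roots) : α ∘ₗ (w : V →ₗ[ℝ] V) ∈ D.roots :=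
  hα.imp (D.comp_mem_realRoots hw) (D.comp_mem_imRoots hw)

theorem mem_titsCone_of_nonneg {v : V} (hv : ∀ i, 0 ≤ D.root i v) : v ∈ D.titsCone := by
  refine ⟨1, one_mem _, {i | D.root i v = 0}, v, ⟨fun i hi => hi, fun i hi => ?_⟩, rfl⟩
  exact lt_of_le_of_ne (hv i) (Ne.symm hi)

theorem exists_dominant_of_mem_titsCone {v : V} (hv : v ∈ D.titsCone) :
    ∃ w ∈ D.vectorialWeyl, ∃ u, (∀ i, 0 ≤ D.root i u) ∧ v = w u := by
  obtain ⟨w, hw, J, u, hu, rfl⟩ := hv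
  refine ⟨w, hw, u, fun i => ?_, rfl⟩
  by_cases hi : i ∈ J
  · exact (hu.1 i hi).ge
  · exact (hu.2 i hi).le

theorem weyl_apply_mem_titsCone {v : V} (hv : v ∈ D.titsCone) {w : V ≃ₗ[ℝ] V}
    (hw : w ∈ D.vectorialWeyl) : w v ∈ D.titsCone := by
  obtain ⟨w', hw', J, u, hu, rfl⟩ := hv
  exact ⟨w * w', mul_mem hw hw', J, u, hu, rfl⟩

theorem smul_mem_titsCone {v : V} (hv : v ∈ D.titsCone) {c : ℝ} (hc : 0 ≤ c) :
    c • v ∈ D.titsCone := by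
  obtain ⟨w, hw, u, hu, rfl⟩ := D.exists_dominant_of_mem_titsCone hv
  rw [← map_smul]
  refine D.weyl_apply_mem_titsCone (D.mem_titsCone_of_nonneg fun i => ?_) hw
  simpa using mul_nonneg hc (hu i)

/-- A dominant vector that is mapped to a nonnegative multiple of itself is fixed. -/
theorem eq_smul_of_dominant {v : V} (hv : ∀ i, 0 ≤ D.root i v) {c : ℝ} (hc : 0 ≤ c)
    (n : ℕ) : ∀ w : D.vectorialWeyl, D.coxeterSystem.length w = n →
      (w : V ≃ₗ[ℝ] V) v = c • v → v = c • v := by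
  induction n with
  | zero =>
    intro w hw h
    rw [D.coxeterSystem.length_eq_zero_iff] at hw
    subst hw
    exact h
  | succ n ih =>
    intro w hw h
    have hne : w ≠ 1 := by
      rintro rfl
      simp at hw
    -- A right descent `i` makes `w αᵢ` negative, whereas `w v = c v` is dominant. Hence `αᵢ(v) ≤
    -- 0`, so `αᵢ(v) = 0`, the reflection `rᵢ` fixes `v`, and `w` can be replaced by the shorter `w
    -- rᵢ`.
    obtain ⟨i, hi⟩ := D.coxeterSystem.exists_rightDescent_of_ne_one hne
    have hlen := (D.coxeterSystem.isRightDescent_iff.1 hi)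
    have hlt : D.coxeterSystem.length (w * D.coxeterSystem.simple i) <
      D.coxeterSystem.length w := hi
    rw [D.coxeter_simple] at hlen hlt
    have hneg := (D.pos_or_neg (D.root i ∘ₗ ((w : V ≃ₗ[ℝ] V).symm : V →ₗ[ℝ] V))
      ⟨w, w.2, i, rfl⟩).resolve_left fun hp => by
        have := (D.pos_iff_length w i).1 hp
        omega
    have h1 := D.nonneg_of_mem_positiveCone hneg (v := (w : V ≃ₗ[ℝ] V) v) fun j => by
      rw [h, map_smul]
      exact mul_nonneg hc (hv j)
    have h2 : D.root i v = 0 := by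
      simp at h1
      exact le_antisymm h1 (hv i)
    refine ih (w * D.simpleReflectionW i) (by omega) ?_
    change (w : V ≃ₗ[ℝ] V) (D.simpleReflection i v) = c • v
    rw [SimpleRoots.simpleReflection, Module.reflection_apply, h2, zero_smul, sub_zero, h]

/-- Conjugation reduces to a dominant vector. This is what forbids a change of speed along a
preordered segment when passing from one apartment to another. -/
theorem eq_one_of_weyl_apply_eq_smul {v : V} (hv : v ∈ D.titsCone) (hv0 : v ≠ 0)
    {w : V ≃ₗ[ℝ] V} (hw : w ∈ D.vectorialWeyl) {c : ℝ} (hc : 0 ≤ c) (h : w v = c • v) :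
    c = 1 := by
  obtain ⟨w', hw', u, hu, rfl⟩ := D.exists_dominant_of_mem_titsCone hv
  have hu0 : u ≠ 0 := by
    rintro rfl
    simp at hv0
  have key := D.eq_smul_of_dominant hu hc _
    ⟨w'⁻¹ * w * w', mul_mem (mul_mem (inv_mem hw') hw) hw'⟩ rfl (by
      change w'.symm (w (w' u)) = c • u
      rw [h, map_smul, LinearEquiv.symm_apply_apply])
  have : (1 - c) • u = 0 := by rw [sub_smul, one_smul, ← key, sub_self]
  have := (smul_eq_zero.1 this).resolve_right hu0
  linarith

/-- Linear independence of the simple roots gives a linear form on the dual that is 1 on each of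
them, and biduality turns it into a vector. If there are no simple roots, any nonzero vector serves.
-/
theorem exists_root_eq_one [FiniteDimensional ℝ V] [Nontrivial V] :
    ∃ u : V, u ≠ 0 ∧ ∀ i, D.root i u = 1 := by
  rcases isEmpty_or_nonempty I with hI | ⟨⟨i₀⟩⟩
  · obtain ⟨u, hu⟩ := exists_ne (0 : V)
    exact ⟨u, hu, fun i => isEmptyElim i⟩
  · let b := Basis.sumExtend D.root_independent
    let φ : Dual ℝ (Dual ℝ V) := b.constr ℝ fun _ => (1 : ℝ)
    have hφ : ∀ i, φ (D.root i) = 1 := fun i => by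
      have : b (Sum.inl i) = D.root i := by
        simp only [b, Basis.sumExtend, Basis.reindex_apply, Basis.extend_apply_self]
        rfl
      rw [← this]
      simp [φ]
    have hu : ∀ i, D.root i ((evalEquiv ℝ V).symm φ) = 1 := fun i => by
      rw [apply_evalEquiv_symm_apply, hφ]
    refine ⟨(evalEquiv ℝ V).symm φ, fun h => ?_, hu⟩
    simpa [h] using hu i₀

end VectorialDatum

/-! ### Closed cells and boxes in the model apartment. -/

namespace ModelApartment

variable {V 𝔸 I : Type*} [NormedAddCommGroup V] [NormedSpace ℝ V] [MetricSpace 𝔸]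
  [NormedAddTorsor V 𝔸] [Fintype I] (D : ModelApartment V 𝔸 I)

theorem linear_mem_vectorialWeyl {w : 𝔸 ≃ᵃ[ℝ] 𝔸} (hw : w ∈ D.weyl) :
    w.linear ∈ D.vectorialWeyl := by
  have : D.weyl ≤ D.vectorialWeyl.comap AffineEquiv.linearHom := by
    refine (Subgroup.closure_le _).2 ?_
    rintro g ⟨M, -, w, hw, i, -, hg, -⟩
    change g.linear ∈ D.vectorialWeyl
    rw [hg]
    exact mul_mem (mul_mem hw (Subgroup.subset_closure (mem_range_self i))) (inv_mem hw)
  exact this hw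

/-- One wall in each simple direction suffices to lift the generators. The lift lets a preordered
pair of points be made dominant by changing the chart. -/
theorem exists_linear_eq {w : V ≃ₗ[ℝ] V} (hw : w ∈ D.vectorialWeyl) :
    ∃ g ∈ D.weyl, g.linear = w := by
  have : D.vectorialWeyl ≤ D.weyl.map AffineEquiv.linearHom := by
    refine (Subgroup.closure_le _).2 ?_
    rintro _ ⟨i, rfl⟩
    obtain ⟨M, hM, hdir⟩ := (D.infinite_walls (D.root i) ⟨1, one_mem _, i, rfl⟩).nonempty
    obtain ⟨p, hp⟩ := D.wall_nonempty M hM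
    let g : 𝔸 ≃ᵃ[ℝ] 𝔸 := AffineEquiv.mk' (fun q => D.simpleReflection i (q -ᵥ p) +ᵥ p)
      (D.simpleReflection i) p (fun q => by simp)
    refine ⟨g, Subgroup.subset_closure ⟨M, hM, 1, one_mem _, i, hdir, ?_, fun q hq => ?_⟩, rfl⟩
    · rw [one_mul, inv_one, mul_one]
      rfl
    · have h : q -ᵥ p ∈ M.direction := AffineSubspace.vsub_mem_direction hq hp
      rw [hdir, LinearMap.mem_ker] at h
      change D.simpleReflection i (q -ᵥ p) +ᵥ p = q
      rw [SimpleRoots.simpleReflection, Module.reflection_apply, h, zero_smul, sub_zero,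
        vsub_vadd]
  obtain ⟨g, hg, h⟩ := this hw
  exact ⟨g, hg, h⟩

variable {D} in
theorem IsClosedCell.preimage {E : Set 𝔸} (hE : D.IsClosedCell E) {w : 𝔸 ≃ᵃ[ℝ] 𝔸}
    (hw : w ∈ D.weyl) : D.IsClosedCell (w ⁻¹' E) := by
  obtain ⟨H, hH, rfl⟩ := hE
  have hl := D.linear_mem_vectorialWeyl hw
  have hl' : (w.linear.symm : V ≃ₗ[ℝ] V) ∈ D.vectorialWeyl := inv_mem hl
  have hcomp : ∀ α : Dual ℝ V, (α ∘ₗ (w.linear : V →ₗ[ℝ] V)) ∘ₗ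
      (w.linear.symm : V →ₗ[ℝ] V) = α := fun α => by
    ext v
    simp
  refine ⟨fun β => w ⁻¹' H (β ∘ₗ (w.linear.symm : V →ₗ[ℝ] V)), fun β hβ => ?_, ?_⟩
  · rcases hH _ (D.comp_mem_roots hl' hβ) with h | ⟨p, hp, h⟩
    · refine Or.inl ?_
      change w ⁻¹' H (β ∘ₗ (w.linear.symm : V →ₗ[ℝ] V)) = univ
      rw [h, preimage_univ]
    · refine Or.inr ⟨w.symm p, hp.imp (fun hp => ⟨?_, ?_⟩) (fun hp => ?_), ?_⟩
      · convert D.comp_mem_realRoots hl hp.1 using 1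
        ext v
        simp
      · have := D.walls_stable w⁻¹ (inv_mem hw) _ hp.2
        rw [AffineSubspace.map_mk'] at this
        have hk : Submodule.map (w⁻¹ : 𝔸 ≃ᵃ[ℝ] 𝔸).toAffineMap.linear
            (LinearMap.ker (β ∘ₗ (w.linear.symm : V →ₗ[ℝ] V))) = LinearMap.ker β := by
          ext v
          simp only [LinearMap.mem_ker, Submodule.mem_map, LinearMap.coe_comp,
            Function.comp_apply]
          constructor
          · rintro ⟨v', hv', rfl⟩
            exact hv'
          · intro hv
            have h : w.linear.symm (w.linear v) = v := by simp
            exact ⟨w.linear v, by simpa using hv, h⟩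
        rw [hk] at this
        exact this
      · convert D.comp_mem_imRoots hl hp using 1
        ext v
        simp
      · change w ⁻¹' H (β ∘ₗ (w.linear.symm : V →ₗ[ℝ] V)) = _
        rw [h]
        ext a
        have : w.linear.symm (w a -ᵥ p) = a -ᵥ w.symm p := by
          rw [LinearEquiv.symm_apply_eq]
          have := w.toAffineMap.linearMap_vsub a (w.symm p)
          simpa using this.symm
        simp [this]
  · ext a
    simp only [mem_preimage, mem_iInter]
    constructor
    · intro h β hβ
      exact h _ (D.comp_mem_roots hl' hβ)
    · intro h α hα
      have := h _ (D.comp_mem_roots hl hα)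
      rwa [hcomp] at this

variable {D} in
/-- Closed cells are convex for the order defined by the fundamental chamber. -/
theorem IsClosedCell.mem_of_between (hD : D.ModeratelyImaginary) {E : Set 𝔸}
    (hE : D.IsClosedCell E) {a b c : 𝔸} (ha : a ∈ E) (hb : b ∈ E)
    (hac : ∀ i, 0 ≤ D.root i (c -ᵥ a)) (hcb : ∀ i, 0 ≤ D.root i (b -ᵥ c)) : c ∈ E := by
  obtain ⟨H, hH, rfl⟩ := hE
  simp only [mem_iInter] at ha hb ⊢
  intro α hα
  have ha' := ha α hα
  have hb' := hb α hα
  rcases hH α hα with h | ⟨p, -, h⟩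
  · rw [h]; trivial
  · rw [h] at ha' hb' ⊢
    simp only [mem_ofPred_eq] at ha' hb' ⊢
    rcases D.root_pos_or_neg hD hα with hp | hn
    · have h1 := D.nonneg_of_mem_positiveCone hp hac
      have : α (c -ᵥ p) = α (c -ᵥ a) + α (a -ᵥ p) := by rw [← map_add, vsub_add_vsub_cancel]
      linarith
    · have h1 := D.nonneg_of_mem_positiveCone hn hcb
      have : α (b -ᵥ p) = α (b -ᵥ c) + α (c -ᵥ p) := by rw [← map_add, vsub_add_vsub_cancel]
      simp only [LinearMap.neg_apply] at h1
      linarith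

variable {D} in
theorem IsClosedCell.isClosed [FiniteDimensional ℝ V] {E : Set 𝔸} (hE : D.IsClosedCell E) :
    IsClosed E := by
  obtain ⟨H, hH, rfl⟩ := hE
  refine isClosed_biInter fun α hα => ?_
  rcases hH α hα with h | ⟨p, -, h⟩
  · rw [h]; exact isClosed_univ
  · rw [h]
    have : Continuous fun a : 𝔸 => α (a -ᵥ p) :=
      (LinearMap.continuous_of_finiteDimensional α).comp (continuous_id.vsub continuous_const)
    exact isClosed_le continuous_const this

variable {D} in
theorem IsClosedCell.lineMap_mem {E : Set 𝔸} (hE : D.IsClosedCell E) {a b : 𝔸}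
    (ha : a ∈ E) (hb : b ∈ E) {t : ℝ} (ht : t ∈ Icc (0 : ℝ) 1) :
    AffineMap.lineMap a b t ∈ E := by
  obtain ⟨H, hH, rfl⟩ := hE
  simp only [mem_iInter] at ha hb ⊢
  intro α hα
  have ha' := ha α hα
  have hb' := hb α hα
  rcases hH α hα with h | ⟨p, -, h⟩
  · rw [h]; trivial
  · rw [h] at ha' hb' ⊢
    simp only [mem_ofPred_eq] at ha' hb' ⊢
    rw [AffineMap.lineMap_apply, vadd_vsub_assoc, map_add, map_smul, smul_eq_mul]
    have : α (b -ᵥ p) = α (b -ᵥ a) + α (a -ᵥ p) := by rw [← map_add, vsub_add_vsub_cancel]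
    nlinarith [ht.1, ht.2, mul_nonneg ht.1 hb', mul_nonneg (sub_nonneg.2 ht.2) ha']

variable {D} in
theorem IsClosedCell.isCell {E : Set 𝔸} (hE : D.IsClosedCell E) : D.IsCell E := by
  obtain ⟨H, hH, rfl⟩ := hE
  exact ⟨H, fun α hα => Or.inl (hH α hα), rfl⟩

theorem ext_of_fixes_box [FiniteDimensional ℝ V] {u : V} (hu : ∀ i, D.root i u = 1)
    (w : 𝔸 ≃ᵃ[ℝ] 𝔸) (a : 𝔸) {ε : ℝ} (hε : 0 < ε)
    (h : ∀ p, (∀ i, 0 ≤ D.root i (p -ᵥ a)) → (∀ i, D.root i (p -ᵥ a) ≤ ε) → w p = p) (p : 𝔸) :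
    w p = p := by
  have ha : w a = a := h a (fun i => by simp) (fun i => by simpa using hε.le)
  obtain ⟨N, hN⟩ : ∃ N : ℝ, ∀ i, |D.root i (p -ᵥ a)| ≤ N :=
    ((eventually_all.2 fun i => eventually_ge_atTop |D.root i (p -ᵥ a)|) :
      ∀ᶠ N : ℝ in atTop, ∀ i, |D.root i (p -ᵥ a)| ≤ N).exists
  -- With this `M`, both `p - a + M u` and `M u` are dominant with simple root values at most `2M`.
  -- Scaled by `s`, they land in the box, and their difference is `p - a`.
  set M := max N 1 with hM
  have hM1 : 0 < M := lt_of_lt_of_le one_pos (le_max_right _ _)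
  set s := ε / (2 * M) with hs
  have hs0 : 0 < s := by positivity
  have hsM : s * (2 * M) = ε := by rw [hs]; field_simp
  have key : ∀ v : V, (∀ i, 0 ≤ D.root i v) → (∀ i, D.root i v ≤ 2 * M) → w.linear v = v := by
    intro v h0 h1
    have := h (s • v +ᵥ a) (fun i => by simpa using mul_nonneg hs0.le (h0 i)) (fun i => by
      simpa [← hsM] using mul_le_mul_of_nonneg_left (h1 i) hs0.le)
    rw [AffineEquiv.map_vadd, ha, vadd_right_cancel_iff, map_smul] at this
    exact smul_right_injective V hs0.ne' this
  have h1 := key (p -ᵥ a + M • u)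
    (fun i => by
      have := neg_abs_le (D.root i (p -ᵥ a))
      have := (hN i).trans (le_max_left N 1)
      simp only [map_add, map_smul, hu, smul_eq_mul]
      linarith)
    (fun i => by
      have := le_abs_self (D.root i (p -ᵥ a))
      have := (hN i).trans (le_max_left N 1)
      simp only [map_add, map_smul, hu, smul_eq_mul]
      linarith)
  have h2 := key (M • u) (fun i => by simpa [hu] using hM1.le) (fun i => by
    simp only [map_smul, hu, smul_eq_mul]
    linarith)
  rw [map_add, h2, add_left_inj] at h1
  have := w.map_vadd a (p -ᵥ a)
  rwa [h1, ha, vsub_vadd] at this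

/-! ### Chambers, facets and sector germs. -/

/-- The open chamber `C` (for `σ = 1`) or `-C` (for `σ = -1`). -/
def chamber (σ : ℝ) : Set V := {v | ∀ i, 0 < σ * D.root i v}

theorem isSphericalFacet_chamber {σ : ℝ} (hσ : σ = 1 ∨ σ = -1) :
    D.IsSphericalFacet (D.chamber σ) := by
  refine ⟨1, one_mem _, ∅, ?_, ?_⟩
  · rw [SimpleRoots.parabolic, image_empty, Subgroup.closure_empty]
    infer_instance
  · refine hσ.imp (fun h => ?_) (fun h => ?_)
    · subst h
      ext v
      simp [chamber, SimpleRoots.stdFacet]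
    · subst h
      ext v
      simp only [chamber, SimpleRoots.stdFacet, mem_ofPred_eq, mem_image]
      refine ⟨fun h => ⟨-v, ⟨by simp, fun i _ => by simpa using h i⟩, by simp⟩, ?_⟩
      rintro ⟨v, ⟨-, h⟩, rfl⟩ i
      simpa using h i (by simp)

theorem isVectorialFacet_chamber {σ : ℝ} (hσ : σ = 1 ∨ σ = -1) :
    D.IsVectorialFacet (D.chamber σ) := by
  obtain ⟨w, hw, J, -, h⟩ := D.isSphericalFacet_chamber hσ
  exact ⟨w, hw, J, h⟩

theorem isVectorialFacet_center : D.IsVectorialFacet (D.stdFacet univ) :=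
  ⟨1, one_mem _, univ, Or.inl (by ext; simp)⟩

theorem zero_mem_center : (0 : V) ∈ D.stdFacet univ := ⟨fun i _ => map_zero _, by simp⟩

theorem mem_of_mem_facet_center {S : Set 𝔸} {x : 𝔸} (hS : S ∈ D.facet x (D.stdFacet univ)) :
    x ∈ S := by
  obtain ⟨E, hE, -, hs⟩ := hS
  have hx : x ∈ (fun v : V => v +ᵥ x) '' D.stdFacet univ :=
    ⟨0, D.zero_mem_center, zero_vadd _ _⟩
  exact hs (mem_of_mem_nhdsWithin hx hE)

theorem mem_nhdsWithin_of_mem_facet {S : Set 𝔸} {x : 𝔸} {F : Set V} (hS : S ∈ D.facet x F) :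
    S ∈ 𝓝[(fun v => v +ᵥ x) '' F] x := by
  obtain ⟨E, hE, -, hs⟩ := hS
  exact mem_of_superset hE hs

-- All simple roots vanish on the direction of this facet, so a closed cell through `x` contains `x`
-- plus that direction. The facet can thus replace the point `x` in (MA3) and (MA4), which speak of
-- facets.
variable {D} in
theorem IsClosedCell.mem_facet_center (hD : D.ModeratelyImaginary) {E : Set 𝔸}
    (hE : D.IsClosedCell E) {x : 𝔸} (hx : x ∈ E) : E ∈ D.facet x (D.stdFacet univ) := by
  refine ⟨E, mem_of_superset self_mem_nhdsWithin ?_, hE.isCell, Subset.rfl⟩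
  rintro _ ⟨v, hv, rfl⟩
  refine hE.mem_of_between hD hx hx (fun i => ?_) (fun i => ?_)
  · simp [hv.1 i trivial]
  · simp [vsub_vadd_eq_vsub_sub, hv.1 i trivial]

variable {D} in
theorem IsClosedCell.mem_facet_chamber [FiniteDimensional ℝ V] (hD : D.ModeratelyImaginary)
    {E : Set 𝔸} (hE : D.IsClosedCell E) {u : V} (hu : ∀ i, D.root i u = 1)
    {σ : ℝ} (hσ : σ = 1 ∨ σ = -1) {x : 𝔸} (hx : x ∈ E) {ε : ℝ} (hε : 0 < ε)
    (hxε : (ε * σ) • u +ᵥ x ∈ E) : E ∈ D.facet x (D.chamber σ) := by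
  refine ⟨E, ?_, hE.isCell, Subset.rfl⟩
  have hopen : {p : 𝔸 | ∀ i, σ * D.root i (p -ᵥ x) < ε} ∈ 𝓝 x := by
    refine (eventually_all.2 fun i => ?_)
    have hc : Continuous fun p : 𝔸 => σ * D.root i (p -ᵥ x) :=
      continuous_const.mul ((LinearMap.continuous_of_finiteDimensional (D.root i)).comp
        (continuous_id.vsub continuous_const))
    exact hc.continuousAt.eventually_lt continuousAt_const (by simpa using hε)
  refine mem_of_superset (inter_mem (mem_nhdsWithin_of_mem_nhds hopen) self_mem_nhdsWithin) ?_
  rintro _ ⟨hp, v, hv, rfl⟩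
  simp only [mem_ofPred_eq, vadd_vsub] at hp
  rcases hσ with rfl | rfl
  · refine hE.mem_of_between hD hx hxε (fun i => ?_) (fun i => ?_)
    · simpa using (hv i).le
    · simpa [hu, vadd_vsub_vadd_cancel_right] using (hp i).le
  · refine hE.mem_of_between hD hxε hx (fun i => ?_) (fun i => ?_)
    · have := hp i
      simp [hu, vadd_vsub_vadd_cancel_right] at this ⊢
      linarith
    · have := hv i
      simp [vsub_vadd_eq_vsub_sub] at this ⊢
      exact this.le

/-- The germ of the sector with direction the chamber of sign `σ`. -/
def sectorGerm (o : 𝔸) (σ : ℝ) : Filter 𝔸 :=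
  D.chimneyGerm (D.facet o (D.stdFacet univ)) (D.chamber σ)

theorem isSplayedChimneyGerm_sectorGerm (o : 𝔸) {σ : ℝ} (hσ : σ = 1 ∨ σ = -1) :
    D.IsSplayedChimneyGerm (D.sectorGerm o σ) :=
  ⟨_, _, ⟨o, _, D.isVectorialFacet_center, rfl⟩, D.isSphericalFacet_chamber hσ, rfl⟩

theorem vadd_mem_of_mem_chimney {S : Set 𝔸} {ξ : V} {o : 𝔸} {σ : ℝ}
    (hS : S ∈ D.chimney (Filter.map (fun a => ξ +ᵥ a) (D.facet o (D.stdFacet univ)))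
      (D.chamber σ)) {v : V} (hv : v ∈ D.chamber σ) : v +ᵥ (ξ +ᵥ o) ∈ S := by
  obtain ⟨E, hE, -, hs⟩ := hS
  obtain ⟨A, hA, B, hB, hAB⟩ := mem_map₂_iff.1 hE
  have ho : o ∈ (fun a => ξ +ᵥ a) ⁻¹' B := D.mem_of_mem_facet_center (mem_map.1 hB)
  exact hs (hAB ⟨v, hA hv, ξ +ᵥ o, ho, rfl⟩)

theorem eventually_add_smul_mem_chamber {u : V} (hu : ∀ i, D.root i u = 1) {σ : ℝ}
    (hσ : σ = 1 ∨ σ = -1) (v : V) : ∀ᶠ t : ℝ in atTop, (t * σ) • u + v ∈ D.chamber σ := by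
  refine eventually_all.2 fun i => ?_
  filter_upwards [eventually_gt_atTop (-(σ * D.root i v))] with t ht
  have : σ * σ = 1 := by rcases hσ with rfl | rfl <;> norm_num
  simp only [map_add, map_smul, hu, smul_eq_mul, mul_one]
  linear_combination ht - t * this

/-- The base point `o` does not matter: moving far enough along `σu` brings any `x` into every
shortening of the sector. -/
theorem eventually_mem_of_mem_sectorGerm {u : V} (hu : ∀ i, D.root i u = 1) {σ : ℝ}
    (hσ : σ = 1 ∨ σ = -1) {o : 𝔸} {S : Set 𝔸} (hS : S ∈ D.sectorGerm o σ) (x : 𝔸) :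
    ∀ᶠ t : ℝ in atTop, (t * σ) • u +ᵥ x ∈ S := by
  have hle : Filter.map (fun t : ℝ => (t * σ) • u +ᵥ x) atTop ≤ D.sectorGerm o σ := by
    refine le_iInf₂ fun ξ _ T hT => ?_
    change ∀ᶠ t : ℝ in atTop, (t * σ) • u +ᵥ x ∈ T
    filter_upwards [D.eventually_add_smul_mem_chamber hu hσ (x -ᵥ (ξ +ᵥ o))] with t ht
    have := D.vadd_mem_of_mem_chimney hT ht
    rwa [add_vadd, vsub_vadd] at this
  exact hle hS

/-- Differences of vectors of a chamber fill `V`, so the support is everything and its pointwise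
fixer is trivial. Solidity lets a sector germ be the second object in (MA3). -/
theorem isSolid_chimney {u : V} (hu : ∀ i, D.root i u = 1) {σ : ℝ} (hσ : σ = 1 ∨ σ = -1)
    (o : 𝔸) : D.IsSolid (D.chimney (D.facet o (D.stdFacet univ)) (D.chamber σ)) := by
  have htop : support (D.chimney (D.facet o (D.stdFacet univ)) (D.chamber σ)) = ⊤ := by
    refine sInf_eq_top.2 fun E hE => ?_
    have hmem : ∀ v ∈ D.chamber σ, v +ᵥ o ∈ E := fun v hv => by
      have := D.vadd_mem_of_mem_chimney (ξ := 0) (S := E) (o := o) (by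
        convert hE
        simp) hv
      simpa using this
    have hdir : E.direction = ⊤ := by
      refine eq_top_iff.2 fun v _ => ?_
      obtain ⟨t, h1, h2⟩ := ((D.eventually_add_smul_mem_chamber hu hσ v).and
        (D.eventually_add_smul_mem_chamber hu hσ 0)).exists
      have := AffineSubspace.vsub_mem_direction (hmem _ h1) (hmem _ h2)
      simpa [vadd_vsub_vadd_cancel_right] using this
    obtain ⟨t, ht⟩ := (D.eventually_add_smul_mem_chamber hu hσ 0).exists
    exact (AffineSubspace.direction_eq_top_iff_of_nonempty ⟨_, hmem _ ht⟩).1 hdir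
  refine (finite_singleton (1 : V ≃ₗ[ℝ] V)).subset ?_
  rintro w ⟨-, hw⟩
  rw [htop, AffineSubspace.direction_top] at hw
  exact LinearEquiv.ext fun v => hw v trivial

theorem isSolidChimneyGerm_sectorGerm {u : V} (hu : ∀ i, D.root i u = 1) (o : 𝔸) {σ : ℝ}
    (hσ : σ = 1 ∨ σ = -1) : D.IsSolidChimneyGerm (D.sectorGerm o σ) :=
  ⟨_, _, ⟨o, _, D.isVectorialFacet_center, rfl⟩, D.isVectorialFacet_chamber hσ,
    D.isSolid_chimney hu hσ o, rfl⟩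

-- The cell contains `x + tσu` for large `t`, and `c` lies in the box between `x` and such a point.
variable {D} in
theorem IsClosedCell.mem_of_mem_sectorGerm (hD : D.ModeratelyImaginary) {E : Set 𝔸}
    (hE : D.IsClosedCell E) {u : V} (hu : ∀ i, D.root i u = 1) {σ : ℝ} (hσ : σ = 1 ∨ σ = -1)
    {o : 𝔸} (hEo : E ∈ D.sectorGerm o σ) {x : 𝔸} (hx : x ∈ E) {c : 𝔸}
    (hc : ∀ i, 0 ≤ σ * D.root i (c -ᵥ x)) : c ∈ E := by
  obtain ⟨t, h1, h2⟩ := ((D.eventually_mem_of_mem_sectorGerm hu hσ hEo x).and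
    (D.eventually_add_smul_mem_chamber hu hσ (x -ᵥ c))).exists
  rw [← vadd_vsub_assoc] at h2
  rcases hσ with rfl | rfl
  · exact hE.mem_of_between hD hx h1 (fun i => by simpa using hc i)
      (fun i => by simpa using (h2 i).le)
  · refine hE.mem_of_between hD h1 hx (fun i => ?_) (fun i => ?_)
    · rw [← neg_vsub_eq_vsub_rev, map_neg]
      simpa using (h2 i).le
    · rw [← neg_vsub_eq_vsub_rev, map_neg]
      simpa using hc i

theorem tendsto_lineMap_nhdsWithin {p q : 𝔸} (hpq : p ≠ q) :
    Tendsto (fun t : ℝ => AffineMap.lineMap p q t) (𝓝[>] 0)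
      (𝓝[affineSegment ℝ p q \ {p}] p) := by
  refine tendsto_nhdsWithin_iff.2 ⟨?_, ?_⟩
  · have : Continuous fun t : ℝ => (AffineMap.lineMap p q t : 𝔸) := AffineMap.lineMap_continuous
    have h := this.tendsto 0
    rw [AffineMap.lineMap_apply_zero] at h
    exact h.mono_left nhdsWithin_le_nhds
  · filter_upwards [Ioc_mem_nhdsGT (zero_lt_one' ℝ)] with t ht
    refine ⟨⟨t, ⟨ht.1.le, ht.2⟩, rfl⟩, fun h => ?_⟩
    rw [mem_singleton_iff, AffineMap.lineMap_eq_left_iff] at h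
    exact h.elim hpq ht.1.ne'

variable {D} in
theorem IsClosedCell.mem_of_mem_nhdsWithin_segment [FiniteDimensional ℝ V] {E : Set 𝔸}
    (hE : D.IsClosedCell E) {p q : 𝔸} (hpq : p ≠ q)
    (h : E ∈ 𝓝[affineSegment ℝ p q \ {p}] p) :
    p ∈ E ∧ ∃ ε ∈ Ioc (0 : ℝ) 1, AffineMap.lineMap p q ε ∈ E := by
  have ht := tendsto_lineMap_nhdsWithin hpq
  have hev : ∀ᶠ t : ℝ in 𝓝[>] 0, (AffineMap.lineMap p q t : 𝔸) ∈ E := ht h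
  refine ⟨hE.isClosed.mem_of_tendsto (ht.mono_right nhdsWithin_le_nhds) hev, ?_⟩
  obtain ⟨ε, h1, h2⟩ := (hev.and (Ioc_mem_nhdsGT (zero_lt_one' ℝ))).exists
  exact ⟨ε, h2, h1⟩

end ModelApartment

end Hovel

namespace Hovel

/-! ### Charts, and the hovel axioms in terms of charts. -/

namespace ApartmentSystem

theorem range_isom {𝔸 X : Type*} {A : Set X} (e : 𝔸 ≃ A) : range (fun p => (e p : X)) = A := by
  ext z
  constructor
  · rintro ⟨p, rfl⟩
    exact (e p).2
  · intro hz
    exact ⟨e.symm ⟨z, hz⟩, by simp⟩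

variable {V 𝔸 I X : Type*} [NormedAddCommGroup V] [NormedSpace ℝ V]
  [MetricSpace 𝔸] [NormedAddTorsor V 𝔸] [Fintype I] {D : ModelApartment V 𝔸 I}
  (H : ApartmentSystem D X)

/-- The charts: the isomorphisms from `𝔸` to an apartment, as maps to `X`. -/
def IsChart (f : 𝔸 → X) : Prop :=
  ∃ A ∈ H.apartments, ∃ e ∈ H.isom A, f = fun p => (e p : X)

variable {H}

namespace IsChart

variable {f g : 𝔸 → X}

theorem range_mem (hf : H.IsChart f) : range f ∈ H.apartments := by
  obtain ⟨A, hA, e, -, rfl⟩ := hf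
  rwa [range_isom]

theorem exists_isom (hf : H.IsChart f) :
    ∃ e ∈ H.isom (range f), f = fun p => (e p : X) := by
  obtain ⟨A, hA, e, he, rfl⟩ := hf
  rw [range_isom]
  exact ⟨e, he, rfl⟩

theorem injective (hf : H.IsChart f) : Function.Injective f := by
  obtain ⟨A, hA, e, -, rfl⟩ := hf
  exact Subtype.val_injective.comp e.injective

theorem comp_weyl (hf : H.IsChart f) {w : 𝔸 ≃ᵃ[ℝ] 𝔸} (hw : w ∈ D.weyl) :
    H.IsChart (f ∘ w) := by
  obtain ⟨A, hA, e, he, rfl⟩ := hf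
  exact ⟨A, hA, w.toEquiv.trans e, (H.mem_isom_iff A hA e he _).2 ⟨w, hw, rfl⟩, rfl⟩

theorem range_comp_equiv (w : 𝔸 ≃ᵃ[ℝ] 𝔸) : range (f ∘ w) = range f :=
  w.surjective.range_comp f

theorem exists_weyl (hf : H.IsChart f) (hg : H.IsChart g) (h : range g = range f) :
    ∃ w ∈ D.weyl, g = f ∘ w := by
  obtain ⟨e, he, hfe⟩ := hf.exists_isom
  obtain ⟨e', he', hge⟩ := hg.exists_isom
  have hA := hf.range_mem
  revert e'
  rw [h]
  intro e' he' hge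
  obtain ⟨w, hw, h'⟩ := (H.mem_isom_iff _ hA e he e').1 he'
  refine ⟨w, hw, ?_⟩
  rw [h'] at hge
  funext p
  rw [congrFun hge p, Function.comp_apply, congrFun hfe (w p)]
  rfl

theorem eq_of_eq_on_box [FiniteDimensional ℝ V] (hf : H.IsChart f) (hg : H.IsChart g)
    (h : range g = range f) {u : V} (hu : ∀ i, D.root i u = 1) (a : 𝔸) {ε : ℝ} (hε : 0 < ε)
    (hbox : ∀ p, (∀ i, 0 ≤ D.root i (p -ᵥ a)) → (∀ i, D.root i (p -ᵥ a) ≤ ε) → f p = g p) :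
    f = g := by
  obtain ⟨w, -, rfl⟩ := hf.exists_weyl hg h
  have := D.ext_of_fixes_box hu w a hε fun p h0 h1 => (hf.injective (hbox p h0 h1)).symm
  funext p
  rw [Function.comp_apply, this]

theorem eq_of_eqOn_closedCell [FiniteDimensional ℝ V] (hD : D.ModeratelyImaginary)
    (hf : H.IsChart f) (hg : H.IsChart g) (h : range g = range f) {u : V}
    (hu : ∀ i, D.root i u = 1) {E : Set 𝔸} (hE : D.IsClosedCell E) (hfg : EqOn f g E) {a : 𝔸}
    (ha : a ∈ E) {ε : ℝ} (hε : 0 < ε) (hb : ε • u +ᵥ a ∈ E) : f = g := by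
  refine hf.eq_of_eq_on_box hg h hu a hε fun p h0 h1 => hfg (hE.mem_of_between hD ha hb h0 ?_)
  intro i
  rw [vadd_vsub_assoc, ← neg_vsub_eq_vsub_rev p a, map_add, map_neg, map_smul, hu, smul_eq_mul]
  linarith [h1 i]

end IsChart

theorem trans_mem_isom {A A' : Set X} (hA : A ∈ H.apartments) (hA' : A' ∈ H.apartments)
    {φ : A ≃ A'} (hφ : H.IsIso A A' φ) {e : 𝔸 ≃ A} (he : e ∈ H.isom A) :
    e.trans φ ∈ H.isom A' := by
  obtain ⟨f, hf, hfφ⟩ := hφ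
  obtain ⟨w, hw, rfl⟩ := (H.mem_isom_iff A hA f hf e).1 he
  exact (H.mem_isom_iff A' hA' _ hfφ _).2 ⟨w, hw, rfl⟩

/-- An isomorphism that fixes the enclosure of a filter yields a chart that agrees with the given
one on a closed cell. -/
theorem exists_chart_of_fixes {f g : 𝔸 → X} (hf : H.IsChart f) (hg : H.IsChart g) {F : Filter 𝔸}
    (h : ∃ φ : range f ≃ range g, H.IsIso (range f) (range g) φ ∧
      Fixes φ (H.enclosure (range f) (map f F))) :
    ∃ k, H.IsChart k ∧ range k = range g ∧ ∃ E, D.IsClosedCell E ∧ E ∈ F ∧ EqOn f k E := by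
  obtain ⟨φ, hφ, hfix⟩ := h
  obtain ⟨e, he, hfe⟩ := hf.exists_isom
  have hk := trans_mem_isom hf.range_mem hg.range_mem hφ he
  refine ⟨fun p => (φ (e p) : X), ⟨_, hg.range_mem, _, hk, rfl⟩, range_isom (e.trans φ), ?_⟩
  have hm : {z | ∃ h : z ∈ range f, (φ ⟨z, h⟩ : X) = z} ∈
      map (fun p => (e p : X)) (D.enclosure (comap (fun p => (e p : X)) (map f F))) :=
    mem_iSup.1 (mem_iSup.1 hfix e) he
  rw [← hfe, comap_map hf.injective] at hm
  obtain ⟨E, hEF, hE, hs⟩ := hm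
  refine ⟨E, hE, hEF, fun p hp => ?_⟩
  obtain ⟨h1, h2⟩ := hs hp
  have : e p = ⟨f p, h1⟩ := Subtype.ext (congrFun hfe p).symm
  change f p = φ (e p)
  rw [this]
  exact h2.symm

theorem IsChart.isIn {f : 𝔸 → X} (hf : H.IsChart f) {P : Filter 𝔸 → Prop} {F : Filter 𝔸}
    (hF : P F) : H.IsIn P (range f) (map f F) := by
  obtain ⟨e, he, hfe⟩ := hf.exists_isom
  exact ⟨e, he, F, hF, by rw [← hfe]⟩

namespace IsAffineHovel

variable {f g : 𝔸 → X}

theorem exists_agree_point (hH : H.IsAffineHovel) (hf : H.IsChart f) (hg : H.IsChart g) {x : 𝔸}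
    (hx : f x ∈ range g) :
    ∃ k, H.IsChart k ∧ range k = range g ∧ ∃ E, D.IsClosedCell E ∧ x ∈ E ∧ EqOn f k E := by
  have := hH.MA2 _ hf.range_mem (map f (𝓟 {x}))
    (Or.inl ⟨f x, mem_range_self x, by simp⟩) _ hg.range_mem (by simpa using hx)
  simpa using exists_chart_of_fixes hf hg this.2

theorem exists_agree_segment [FiniteDimensional ℝ V] (hH : H.IsAffineHovel) (hf : H.IsChart f)
    (hg : H.IsChart g) {p q : 𝔸} (hpq : p ≠ q) (hle : D.Le p q ∨ D.Le q p)
    (hx : ∀ᶠ m in 𝓝[affineSegment ℝ p q \ {p}] p, f m ∈ range g) :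
    ∃ k, H.IsChart k ∧ range k = range g ∧ ∃ E, D.IsClosedCell E ∧ p ∈ E ∧
      (∃ ε ∈ Ioc (0 : ℝ) 1, AffineMap.lineMap p q ε ∈ E) ∧ EqOn f k E := by
  have := hH.MA2 _ hf.range_mem (map f (𝓝[affineSegment ℝ p q \ {p}] p))
    (Or.inr (Or.inl (hf.isIn ⟨p, q, hpq, hle, rfl⟩))) _ hg.range_mem hx
  obtain ⟨k, hk, hr, E, hE, hEF, heq⟩ := exists_chart_of_fixes hf hg this.2
  obtain ⟨h1, h2⟩ := hE.mem_of_mem_nhdsWithin_segment hpq hEF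
  exact ⟨k, hk, hr, E, hE, h1, h2, heq⟩

theorem exists_chart_facet (hH : H.IsAffineHovel) (hf : H.IsChart f) (hg : H.IsChart g)
    {σ : ℝ} (hσ : σ = 1 ∨ σ = -1) (o : 𝔸) (x : 𝔸) {F : Set V} (hF : D.IsVectorialFacet F) :
    ∃ k, H.IsChart k ∧ (∀ᶠ p in D.sectorGerm o σ, f p ∈ range k) ∧
      ∀ᶠ p in D.facet x F, g p ∈ range k := by
  obtain ⟨A, hA, h1, h2⟩ := hH.MA3 _ hf.range_mem _ hg.range_mem _ _
    (hf.isIn (D.isSplayedChimneyGerm_sectorGerm o hσ))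
    (Or.inl (hg.isIn (P := D.IsFacet) ⟨x, F, hF, rfl⟩))
  obtain ⟨e, he⟩ := H.isom_nonempty A hA
  refine ⟨fun p => (e p : X), ⟨A, hA, e, he, rfl⟩, ?_⟩
  rw [range_isom]
  exact ⟨h1, h2⟩

theorem exists_chart_sector (hH : H.IsAffineHovel) (hf : H.IsChart f) (hg : H.IsChart g)
    {u : V} (hu : ∀ i, D.root i u = 1) {σ τ : ℝ} (hσ : σ = 1 ∨ σ = -1) (hτ : τ = 1 ∨ τ = -1)
    (o : 𝔸) :
    ∃ k, H.IsChart k ∧ (∀ᶠ p in D.sectorGerm o σ, f p ∈ range k) ∧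
      ∀ᶠ p in D.sectorGerm o τ, g p ∈ range k := by
  obtain ⟨A, hA, h1, h2⟩ := hH.MA3 _ hf.range_mem _ hg.range_mem _ _
    (hf.isIn (D.isSplayedChimneyGerm_sectorGerm o hσ))
    (Or.inr (hg.isIn (D.isSolidChimneyGerm_sectorGerm hu o hτ)))
  obtain ⟨e, he⟩ := H.isom_nonempty A hA
  refine ⟨fun p => (e p : X), ⟨A, hA, e, he, rfl⟩, ?_⟩
  rw [range_isom]
  exact ⟨h1, h2⟩

theorem exists_agree_facet (hH : H.IsAffineHovel) (hf : H.IsChart f) (hg : H.IsChart g)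
    {σ : ℝ} (hσ : σ = 1 ∨ σ = -1) {o : 𝔸} {x : 𝔸} {F : Set V} (hF : D.IsVectorialFacet F)
    (h1 : ∀ᶠ p in D.sectorGerm o σ, f p ∈ range g) (h2 : ∀ᶠ p in D.facet x F, f p ∈ range g) :
    ∃ k, H.IsChart k ∧ range k = range g ∧ ∃ E, D.IsClosedCell E ∧
      E ∈ D.sectorGerm o σ ∧ E ∈ D.facet x F ∧ EqOn f k E := by
  have := hH.MA4 _ hf.range_mem _ hf.range_mem _ _
    (hf.isIn (D.isSplayedChimneyGerm_sectorGerm o hσ))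
    (Or.inl (hf.isIn (P := D.IsFacet) ⟨x, F, hF, rfl⟩)) _ hf.range_mem _ hg.range_mem
    (by simp) (by simp) h1 h2
  rw [← Filter.map_sup] at this
  obtain ⟨k, hk, hr, E, hE, hEF, heq⟩ := exists_chart_of_fixes hf hg this.2
  exact ⟨k, hk, hr, E, hE, hEF.1, hEF.2, heq⟩

/-- Two apartments that share a sector germ and a point are related by an isomorphism fixing a
closed cell that contains both. -/
theorem exists_agree_sector_point (hH : H.IsAffineHovel) (hD : D.ModeratelyImaginary)
    (hf : H.IsChart f) (hg : H.IsChart g) {σ : ℝ} (hσ : σ = 1 ∨ σ = -1) {o x : 𝔸}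
    (h1 : ∀ᶠ p in D.sectorGerm o σ, f p ∈ range g) (hx : f x ∈ range g) :
    ∃ k, H.IsChart k ∧ range k = range g ∧ ∃ E, D.IsClosedCell E ∧
      E ∈ D.sectorGerm o σ ∧ x ∈ E ∧ EqOn f k E := by
  -- (MA4) requires the second apartment to contain a facet at `x`, not only `x`. By (MA2) for the
  -- point, the two apartments share a closed cell through `x`, hence that facet.
  obtain ⟨k', -, hr', E', hE', hxE', heq'⟩ := hH.exists_agree_point hf hg hx
  obtain ⟨k, hk, hr, E, hE, hES, hEF, heq⟩ := hH.exists_agree_facet hf hg hσ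
    D.isVectorialFacet_center h1 (x := x) (by
      filter_upwards [hE'.mem_facet_center hD hxE'] with p hp
      rw [heq' hp, ← hr']
      exact mem_range_self p)
  exact ⟨k, hk, hr, E, hE, hES, D.mem_of_mem_facet_center hEF, heq⟩

end IsAffineHovel

end ApartmentSystem

end Hovel

namespace Hovel

namespace ModelApartment

variable {V 𝔸 I : Type*} [NormedAddCommGroup V] [NormedSpace ℝ V] [MetricSpace 𝔸]
  [NormedAddTorsor V 𝔸] [Fintype I] {D : ModelApartment V 𝔸 I}

theorem IsClosedCell.smul_vadd_mem (hD : D.ModeratelyImaginary) {E : Set 𝔸}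
    (hE : D.IsClosedCell E) {u : V} (hu : ∀ i, D.root i u = 1) {x : 𝔸} {a b c : ℝ}
    (ha : a • u +ᵥ x ∈ E) (hb : b • u +ᵥ x ∈ E) (hac : a ≤ c) (hcb : c ≤ b) :
    c • u +ᵥ x ∈ E :=
  hE.mem_of_between hD ha hb
    (fun i => by simpa [vadd_vsub_vadd_cancel_right, hu] using hac)
    (fun i => by simpa [vadd_vsub_vadd_cancel_right, hu] using hcb)

theorem lineMap_smul_vadd (u : V) (x : 𝔸) (a b t : ℝ) :
    AffineMap.lineMap (a • u +ᵥ x) (b • u +ᵥ x) t = (a + t * (b - a)) • u +ᵥ x := by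
  rw [AffineMap.lineMap_apply, vadd_vsub_vadd_cancel_right, vadd_vadd, ← sub_smul, smul_smul,
    ← add_smul, add_comm]

/-- Trades the germ of a chamber for the germ of an interval in direction `σu`, which is preordered
and therefore accessible to (MA2). -/
theorem mem_nhdsWithin_segment_of_mem_facet_chamber {S : Set 𝔸} {u : V}
    (hu : ∀ i, D.root i u = 1) {σ : ℝ} (hσ : σ = 1 ∨ σ = -1) {x : 𝔸}
    (hS : S ∈ D.facet x (D.chamber σ)) :
    S ∈ 𝓝[affineSegment ℝ x (σ • u +ᵥ x) \ {x}] x := by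
  refine nhdsWithin_mono x ?_ (D.mem_nhdsWithin_of_mem_facet hS)
  rintro _ ⟨⟨t, ht, rfl⟩, hne⟩
  have ht0 : 0 < t := lt_of_le_of_ne ht.1 fun h => hne (by simp [← h])
  refine ⟨t • σ • u, fun i => ?_, by simp [AffineMap.lineMap_apply]⟩
  rcases hσ with rfl | rfl <;> simpa [hu] using ht0

theorem IsClosedCell.mem_of_mem_facet_chamber [FiniteDimensional ℝ V] {E : Set 𝔸}
    (hE : D.IsClosedCell E) {u : V} (hu : ∀ i, D.root i u = 1) (hu0 : u ≠ 0) {σ : ℝ}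
    (hσ : σ = 1 ∨ σ = -1) {x : 𝔸} (h : E ∈ D.facet x (D.chamber σ)) :
    x ∈ E ∧ ∃ ε > 0, (ε * σ) • u +ᵥ x ∈ E := by
  have hne : x ≠ σ • u +ᵥ x := fun h => by
    have h' : σ • u = 0 := vadd_right_cancel x (h.symm.trans (zero_vadd V x).symm)
    rcases hσ with rfl | rfl <;> simp [hu0] at h'
  obtain ⟨h1, ε, hε, h2⟩ := hE.mem_of_mem_nhdsWithin_segment hne
    (mem_nhdsWithin_segment_of_mem_facet_chamber hu hσ h)
  refine ⟨h1, ε, hε.1, ?_⟩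
  simpa [AffineMap.lineMap_apply, smul_smul] using h2

end ModelApartment

/-! ### Agreement of charts along preordered segments and near chambers. -/

namespace ApartmentSystem

variable {V 𝔸 I X : Type*} [NormedAddCommGroup V] [NormedSpace ℝ V]
  [MetricSpace 𝔸] [NormedAddTorsor V 𝔸] [Fintype I] {D : ModelApartment V 𝔸 I}
  {H : ApartmentSystem D X} {f g : 𝔸 → X}

theorem IsChart.segmentIn_eq (hf : H.IsChart f) (p q : 𝔸) :
    H.segmentIn (range f) (f p) (f q) = f '' affineSegment ℝ p q := by
  ext z
  constructor
  · rintro ⟨e', he', p', q', hp, hq, m, hm, rfl⟩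
    obtain ⟨w, -, hw⟩ := hf.exists_weyl (g := fun p => (e' p : X))
      ⟨_, hf.range_mem, e', he', rfl⟩ (range_isom e')
    have hw' : ∀ a, (e' a : X) = f (w a) := congrFun hw
    rw [hw'] at hp hq
    rw [← hf.injective hp, ← hf.injective hq, hw']
    refine mem_image_of_mem f ?_
    have := affineSegment_image (w : 𝔸 →ᵃ[ℝ] 𝔸) p' q'
    exact this ▸ mem_image_of_mem w hm
  · rintro ⟨m, hm, rfl⟩
    obtain ⟨e, he, hfe⟩ := hf.exists_isom
    have h := fun a => (congrFun hfe a).symm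
    exact ⟨e, he, p, q, h p, h q, m, hm, h m⟩

theorem IsChart.leIn (hf : H.IsChart f) {p q : 𝔸} (hle : D.Le p q) :
    H.LeIn (range f) (f p) (f q) := by
  obtain ⟨e, he, hfe⟩ := hf.exists_isom
  have h := fun a => (congrFun hfe a).symm
  exact ⟨e, he, p, q, h p, h q, hle⟩

theorem IsOrdered.image_segment_eq (hO : H.IsOrdered) (hf : H.IsChart f) (hg : H.IsChart g)
    {p q p' q' : 𝔸} (hle : D.Le p q) (hp : f p = g p') (hq : f q = g q') :
    f '' affineSegment ℝ p q = g '' affineSegment ℝ p' q' := by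
  have := hO (f p) (f q) _ hf.range_mem _ hg.range_mem (mem_range_self p) (mem_range_self q)
    (hp ▸ mem_range_self p') (hq ▸ mem_range_self q') (hf.leIn hle)
  rwa [hf.segmentIn_eq, hp, hq, hg.segmentIn_eq] at this

/-- Two charts that agree at `p` and at another point of a segment `[p, q]` with `p ≤ q` agree on
that segment, if `q` is in both apartments. -/
theorem eq_on_segment [FiniteDimensional ℝ V] (hH : H.IsAffineHovel) (hO : H.IsOrdered)
    (hf : H.IsChart f) (hg : H.IsChart g) {p q : 𝔸} (hle : D.Le p q) (hp : f p = g p)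
    (hε : ∃ ε ∈ Ioc (0 : ℝ) 1, f (AffineMap.lineMap p q ε) = g (AffineMap.lineMap p q ε))
    (hq : f q ∈ range g) :
    ∀ t ∈ Icc (0 : ℝ) 1, f (AffineMap.lineMap p q t) = g (AffineMap.lineMap p q t) := by
  rcases eq_or_ne p q with rfl | hpq
  · intro t _
    simpa using hp
  obtain ⟨q', hq'⟩ := hq
  set v := q -ᵥ p with hv
  have hv0 : v ≠ 0 := fun h => hpq (vsub_eq_zero_iff_eq.1 h).symm
  have hline : ∀ t : ℝ, AffineMap.lineMap p q t = t • v +ᵥ p := AffineMap.lineMap_apply p q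
  have hinj : ∀ {a b : ℝ}, a • v +ᵥ p = b • v +ᵥ p → a = b := fun h =>
    smul_left_injective ℝ hv0 (vadd_right_cancel p h)
  simp only [hline] at hε ⊢
  -- The second point of agreement forces `q'`, the preimage of `f q` under `g`, onto the open ray
  -- from `p` through `q`: by (MAO) it equals `p + τ (q' - p)` for some `τ`, so `τ (q' - p) = ε v`.
  obtain ⟨l, hl, hql⟩ : ∃ l : ℝ, 0 < l ∧ q' = l • v +ᵥ p := by
    obtain ⟨ε, hε, heq⟩ := hε
    have hm : f (ε • v +ᵥ p) ∈ f '' affineSegment ℝ p q :=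
      mem_image_of_mem f ⟨ε, ⟨hε.1.le, hε.2⟩, hline ε⟩
    rw [hO.image_segment_eq hf hg hle hp hq'.symm] at hm
    obtain ⟨_, ⟨τ, hτ, rfl⟩, h⟩ := hm
    rw [heq] at h
    have h := hg.injective h
    rw [AffineMap.lineMap_apply] at h
    have h := vadd_right_cancel p h
    have hτ0 : τ ≠ 0 := by
      rintro rfl
      rw [zero_smul] at h
      exact (smul_ne_zero hε.1.ne' hv0) h.symm
    refine ⟨ε / τ, div_pos hε.1 (lt_of_le_of_ne hτ.1 hτ0.symm), ?_⟩
    rw [div_eq_inv_mul, ← smul_smul, ← h, inv_smul_smul₀ hτ0, vsub_vadd]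
  -- By (MAO), `f` and `g` trace the same segment up to a reparametrization `s`, constrained only on
  -- `[0, 1]`. The goal is `s t = t`.
  have hex : ∀ t : ℝ, ∃ s : ℝ, t ∈ Icc (0 : ℝ) 1 →
      s ≤ l ∧ f (t • v +ᵥ p) = g (s • v +ᵥ p) := by
    intro t
    by_cases ht : t ∈ Icc (0 : ℝ) 1
    · have hm : f (t • v +ᵥ p) ∈ f '' affineSegment ℝ p q :=
        mem_image_of_mem f ⟨t, ht, hline t⟩
      rw [hO.image_segment_eq hf hg hle hp hq'.symm] at hm
      obtain ⟨_, ⟨τ, hτ, rfl⟩, h⟩ := hm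
      refine ⟨τ * l, fun _ => ⟨by nlinarith [hτ.2], ?_⟩⟩
      rw [← h, AffineMap.lineMap_apply, hql, vadd_vsub, smul_smul]
    · exact ⟨0, fun h => absurd h ht⟩
  choose s hs using hex
  -- (MAO) for the subsegment from parameter `t` to `q` puts `s t'` between `s t` and `l`.
  have hmono : ∀ t ∈ Icc (0 : ℝ) 1, ∀ t' ∈ Icc (0 : ℝ) 1, t ≤ t' → s t ≤ s t' := by
    intro t ht t' ht' htt'
    have hle' : D.Le (t • v +ᵥ p) q := by
      change q -ᵥ (t • v +ᵥ p) ∈ D.titsCone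
      have : q -ᵥ (t • v +ᵥ p) = (1 - t) • v := by
        rw [vsub_vadd_eq_vsub_sub, ← hv, sub_smul, one_smul]
      rw [this]
      exact D.smul_mem_titsCone hle (sub_nonneg.2 ht.2)
    have hqv : q = (1 : ℝ) • v +ᵥ p := by rw [one_smul, hv, vsub_vadd]
    have hm : f (t' • v +ᵥ p) ∈ f '' affineSegment ℝ (t • v +ᵥ p) q := by
      refine mem_image_of_mem f ?_
      rcases eq_or_ne t 1 with rfl | ht1
      · obtain rfl : t' = 1 := le_antisymm ht'.2 htt'
        exact left_mem_affineSegment ℝ _ _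
      · have h1 : 0 < 1 - t := sub_pos.2 (lt_of_le_of_ne ht.2 ht1)
        refine ⟨(t' - t) / (1 - t), ⟨div_nonneg (sub_nonneg.2 htt') h1.le,
          (div_le_one h1).2 (by linarith [ht'.2])⟩, ?_⟩
        rw [hqv, ModelApartment.lineMap_smul_vadd, div_mul_cancel₀ _ h1.ne']
        congr 2
        ring
    rw [hO.image_segment_eq hf hg hle' (hs t ht).2 hq'.symm] at hm
    obtain ⟨_, ⟨r, hr, rfl⟩, h⟩ := hm
    rw [(hs t' ht').2, hql, ModelApartment.lineMap_smul_vadd] at h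
    have h := hinj (hg.injective h)
    nlinarith [hr.1, (hs t ht).1]
  -- Near `t`, on the side of `t₁`, (MA2) makes `f` agree with `g ∘ w` for some `w` in `W`. The
  -- linear part of `w` then multiplies `v` by the slope of `s`, which is nonnegative by
  -- monotonicity and hence equal to 1.
  have hloc : ∀ t ∈ Icc (0 : ℝ) 1, ∀ t₁ ∈ Icc (0 : ℝ) 1, t ≠ t₁ → ∃ ε ∈ Ioc (0 : ℝ) 1,
      ∀ r ∈ Icc (0 : ℝ) ε, s (t + r * (t₁ - t)) - (t + r * (t₁ - t)) = s t - t := by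
    intro t ht t₁ ht₁ hne
    have hne' : t • v +ᵥ p ≠ t₁ • v +ᵥ p := fun h => hne (hinj h)
    have hcomb : ∀ r ∈ Icc (0 : ℝ) 1, t + r * (t₁ - t) ∈ Icc (0 : ℝ) 1 := fun r hr => by
      constructor
      · nlinarith [hr.1, hr.2, ht.1, ht₁.1, mul_nonneg hr.1 ht₁.1,
          mul_nonneg (sub_nonneg.2 hr.2) ht.1]
      · nlinarith [hr.1, hr.2, ht.2, ht₁.2, mul_nonneg hr.1 (sub_nonneg.2 ht₁.2),
          mul_nonneg (sub_nonneg.2 hr.2) (sub_nonneg.2 ht.2)]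
    have hle' : ∀ a b : ℝ, a ≤ b → D.Le (a • v +ᵥ p) (b • v +ᵥ p) := fun a b hab => by
      change (b • v +ᵥ p) -ᵥ (a • v +ᵥ p) ∈ D.titsCone
      rw [vadd_vsub_vadd_cancel_right, ← sub_smul]
      exact D.smul_mem_titsCone hle (sub_nonneg.2 hab)
    obtain ⟨k, hk, hr, E, hE, h0, ⟨ε, hε, h1⟩, heq⟩ :=
      hH.exists_agree_segment hf hg hne' ((le_total t t₁).imp (hle' _ _) (hle' _ _)) (by
        filter_upwards [self_mem_nhdsWithin] with m hm
        obtain ⟨⟨r, hr, rfl⟩, -⟩ := hm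
        rw [ModelApartment.lineMap_smul_vadd, (hs _ (hcomb r hr)).2]
        exact mem_range_self _)
    obtain ⟨w, hw, rfl⟩ := hg.exists_weyl hk hr
    refine ⟨ε, hε, fun r hr => ?_⟩
    have hr1 : r ∈ Icc (0 : ℝ) 1 := ⟨hr.1, hr.2.trans hε.2⟩
    rw [ModelApartment.lineMap_smul_vadd] at h1
    have hmem : (t + r * (t₁ - t)) • v +ᵥ p ∈ E := by
      have := hE.lineMap_mem h0 h1 (t := r / ε)
        ⟨div_nonneg hr.1 hε.1.le, (div_le_one hε.1).2 hr.2⟩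
      rw [ModelApartment.lineMap_smul_vadd] at this
      convert this using 3
      field_simp [hε.1.ne']
      ring
    rcases eq_or_ne r 0 with rfl | hr0
    · simp
    have hd : r * (t₁ - t) ≠ 0 := mul_ne_zero hr0 (sub_ne_zero.2 hne.symm)
    set t' := t + r * (t₁ - t) with ht'
    have ht'm := hcomb r hr1
    have e0 := hg.injective ((hs t ht).2.symm.trans (heq h0))
    have e1 := hg.injective ((hs t' ht'm).2.symm.trans (heq hmem))
    have e2 : (s t' - s t) • v = (t' - t) • w.linear v := by
      rw [sub_smul, ← vadd_vsub_vadd_cancel_right _ _ p, e0, e1, AffineEquiv.map_vadd,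
        AffineEquiv.map_vadd, vadd_vsub_vadd_cancel_right, map_smul, map_smul, sub_smul]
    have hd' : t' - t ≠ 0 := by simpa [ht'] using hd
    have e3 : w.linear v = ((s t' - s t) / (t' - t)) • v := by
      rw [div_eq_inv_mul, ← smul_smul, e2, inv_smul_smul₀ hd']
    have hnn : 0 ≤ (s t' - s t) / (t' - t) := by
      rcases le_total t t' with h | h
      · exact div_nonneg (sub_nonneg.2 (hmono t ht t' ht'm h)) (sub_nonneg.2 h)
      · exact div_nonneg_of_nonpos (sub_nonpos.2 (hmono t' ht'm t ht h)) (sub_nonpos.2 h)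
    have := D.eq_one_of_weyl_apply_eq_smul hle hv0 (D.linear_mem_vectorialWeyl hw) hnn e3
    rw [div_eq_one_iff_eq hd'] at this
    linarith
  have hside : ∀ t ∈ Icc (0 : ℝ) 1, ∀ t₁ ∈ Icc (0 : ℝ) 1, t ≠ t₁ → ∃ δ > 0, ∀ t' : ℝ,
      0 ≤ (t' - t) / (t₁ - t) → |t' - t| < δ → s t' - t' = s t - t := by
    intro t ht t₁ ht₁ hne
    obtain ⟨ε, hε, h⟩ := hloc t ht t₁ ht₁ hne
    have hpos : 0 < |t₁ - t| := abs_pos.2 (sub_ne_zero.2 hne.symm)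
    refine ⟨ε * |t₁ - t|, mul_pos hε.1 hpos, fun t' h0 hlt => ?_⟩
    have h1 : (t' - t) / (t₁ - t) ≤ ε := by
      rw [← abs_of_nonneg h0, abs_div, div_le_iff₀ hpos]
      exact hlt.le
    have := h _ ⟨h0, h1⟩
    rwa [div_mul_cancel₀ _ (sub_ne_zero.2 hne.symm), add_sub_cancel] at this
  -- The function `s t - t` is locally constant on both sides of each point, and `[0, 1]` is
  -- connected.
  have hconst : ∀ t ∈ Icc (0 : ℝ) 1, s 0 - 0 = s t - t := by
    intro t ht
    refine isPreconnected_Icc.induction₂ (fun a b : ℝ => s a - a = s b - b) ?_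
      (fun _ _ _ _ _ _ h h' => h.trans h') (fun _ _ _ _ h => h.symm)
      (left_mem_Icc.2 zero_le_one) ht
    intro t ht
    have hR : ∃ δ > 0, ∀ t' ∈ Icc (0 : ℝ) 1, t ≤ t' → |t' - t| < δ → s t' - t' = s t - t := by
      rcases eq_or_lt_of_le ht.2 with rfl | h
      · exact ⟨1, one_pos, fun t' ht' h _ => by rw [le_antisymm ht'.2 h]⟩
      · obtain ⟨δ, hδ, hh⟩ := hside t ht 1 (right_mem_Icc.2 zero_le_one) h.ne
        exact ⟨δ, hδ, fun t' _ h' => hh t' (div_nonneg (by linarith) (by linarith))⟩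
    have hL : ∃ δ > 0, ∀ t' ∈ Icc (0 : ℝ) 1, t' ≤ t → |t' - t| < δ → s t' - t' = s t - t := by
      rcases eq_or_lt_of_le ht.1 with rfl | h
      · exact ⟨1, one_pos, fun t' ht' h _ => by rw [le_antisymm h ht'.1]⟩
      · obtain ⟨δ, hδ, hh⟩ := hside t ht 0 (left_mem_Icc.2 zero_le_one) h.ne'
        exact ⟨δ, hδ, fun t' _ h' =>
          hh t' (div_nonneg_of_nonpos (by linarith) (by linarith))⟩
    obtain ⟨δ, hδ, hR⟩ := hR
    obtain ⟨δ', hδ', hL⟩ := hL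
    filter_upwards [self_mem_nhdsWithin,
      mem_nhdsWithin_of_mem_nhds (Metric.ball_mem_nhds t (lt_min hδ hδ'))] with t' ht' hb
    rw [Metric.mem_ball, Real.dist_eq] at hb
    rcases le_total t t' with h | h
    · exact (hR t' ht' h (hb.trans_le (min_le_left _ _))).symm
    · exact (hL t' ht' h (hb.trans_le (min_le_right _ _))).symm
  have hs0 : s 0 = 0 := by
    have := (hs 0 (left_mem_Icc.2 zero_le_one)).2
    rw [zero_smul, zero_vadd, hp] at this
    have := hg.injective this
    refine hinj ?_
    rw [← this, zero_smul, zero_vadd]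
  intro t ht
  have : s t = t := by linarith [hconst t ht]
  rw [(hs t ht).2, this]

/-- Two charts that agree near `a` in the direction of the fundamental chamber agree at every
common point that is larger than `a` for the order defined by this chamber. -/
theorem eq_of_dominant [FiniteDimensional ℝ V] (hD : D.ModeratelyImaginary)
    (hH : H.IsAffineHovel) (hO : H.IsOrdered) (hf : H.IsChart f) (hg : H.IsChart g) {u : V} (hu : ∀ i, D.root i u = 1)
    {E : Set 𝔸} (hE : D.IsClosedCell E) (hfg : EqOn f g E) {a : 𝔸} (ha : a ∈ E) {ε : ℝ}
    (hε : 0 < ε) (hb : ε • u +ᵥ a ∈ E) {q : 𝔸} (haq : ∀ i, 0 ≤ D.root i (q -ᵥ a))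
    (hq : f q ∈ range g) : f q = g q := by
  have hle : D.Le a q := D.mem_titsCone_of_nonneg haq
  have hev : ∀ᶠ t : ℝ in 𝓝[>] 0, ∀ i, t * D.root i (q -ᵥ a) < ε := by
    refine eventually_all.2 fun i => nhdsWithin_le_nhds ?_
    have hc : Continuous fun t : ℝ => t * D.root i (q -ᵥ a) := by fun_prop
    exact hc.continuousAt.eventually_lt continuousAt_const (by simpa using hε)
  -- For small `t`, the point `a + t (q - a)` is in the box from `a` to `a + εu`; it is the second
  -- point of agreement for `eq_on_segment`.
  obtain ⟨t, h1, ht⟩ := (hev.and (Ioc_mem_nhdsGT (zero_lt_one' ℝ))).exists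
  have := eq_on_segment hH hO hf hg hle (hfg ha) ⟨t, ht, hfg (hE.mem_of_between hD ha hb
    (fun i => ?_) (fun i => ?_))⟩ hq 1 (right_mem_Icc.2 zero_le_one)
  · simpa using this
  · simpa [AffineMap.lineMap_apply] using mul_nonneg ht.1.le (haq i)
  · simpa [AffineMap.lineMap_apply, vadd_vsub_vadd_cancel_right, hu] using (h1 i).le

/-- Two apartments that share the germ of a chamber at a point are related by an isomorphism
fixing that germ. -/
theorem IsAffineHovel.exists_agree_chamber [FiniteDimensional ℝ V] (hH : H.IsAffineHovel)
    (hf : H.IsChart f) (hg : H.IsChart g) {u : V} (hu : ∀ i, D.root i u = 1) (hu0 : u ≠ 0) {σ : ℝ}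
    (hσ : σ = 1 ∨ σ = -1) {x : 𝔸} (hx : ∀ᶠ p in D.facet x (D.chamber σ), f p ∈ range g) :
    ∃ k, H.IsChart k ∧ range k = range g ∧ ∃ E, D.IsClosedCell E ∧ x ∈ E ∧
      (∃ ε > 0, (ε * σ) • u +ᵥ x ∈ E) ∧ EqOn f k E := by
  have hne : x ≠ σ • u +ᵥ x := fun h => by
    have h' : σ • u = 0 := vadd_right_cancel x (h.symm.trans (zero_vadd V x).symm)
    rcases hσ with rfl | rfl <;> simp [hu0] at h'
  have hle : D.Le x (σ • u +ᵥ x) ∨ D.Le (σ • u +ᵥ x) x := by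
    refine hσ.imp ?_ ?_
    · rintro rfl
      exact D.mem_titsCone_of_nonneg fun i => by simp [hu]
    · rintro rfl
      exact D.mem_titsCone_of_nonneg fun i => by simp [vsub_vadd_eq_vsub_sub, hu]
  obtain ⟨k, hk, hr, E, hE, h0, ⟨ε, hε, h1⟩, heq⟩ := hH.exists_agree_segment hf hg hne hle
    (ModelApartment.mem_nhdsWithin_segment_of_mem_facet_chamber hu hσ hx)
  refine ⟨k, hk, hr, E, hE, h0, ⟨ε, hε.1, ?_⟩, heq⟩
  simpa [AffineMap.lineMap_apply, smul_smul] using h1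

/-- Two apartments that share a sector germ and the germ of a chamber at a point are related by an
isomorphism fixing a closed cell that contains both. -/
theorem IsAffineHovel.exists_agree_sector_chamber [FiniteDimensional ℝ V]
    (hH : H.IsAffineHovel)
    (hD : D.ModeratelyImaginary) (hf : H.IsChart f) (hg : H.IsChart g) {u : V}
    (hu : ∀ i, D.root i u = 1) (hu0 : u ≠ 0) {σ τ : ℝ} (hσ : σ = 1 ∨ σ = -1)
    (hτ : τ = 1 ∨ τ = -1) {o x : 𝔸} (h1 : ∀ᶠ p in D.sectorGerm o σ, f p ∈ range g) {E : Set 𝔸}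
    (hE : D.IsClosedCell E) (hx : x ∈ E) {ε : ℝ} (hε : 0 < ε) (hb : (ε * τ) • u +ᵥ x ∈ E)
    (hfE : ∀ p ∈ E, f p ∈ range g) :
    ∃ k, H.IsChart k ∧ range k = range g ∧ ∃ E, D.IsClosedCell E ∧ E ∈ D.sectorGerm o σ ∧
      x ∈ E ∧ (∃ ε > 0, (ε * τ) • u +ᵥ x ∈ E) ∧ EqOn f k E := by
  obtain ⟨k, hk, hr, E', hE', hES, hEF, heq⟩ := hH.exists_agree_facet hf hg hσ
    (D.isVectorialFacet_chamber hτ) h1 (x := x) (by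
      filter_upwards [hE.mem_facet_chamber hD hu hτ hx hε hb] with p hp using hfE p hp)
  obtain ⟨h2, h3⟩ := hE'.mem_of_mem_facet_chamber hu hu0 hτ hEF
  exact ⟨k, hk, hr, E', hE', hES, h2, h3, heq⟩

end ApartmentSystem

end Hovel

namespace Hovel

/-! ### Joining opposite sectors by sliding along the ray `x - tu`. -/

namespace ApartmentSystem

variable {V 𝔸 I X : Type*} [NormedAddCommGroup V] [NormedSpace ℝ V]
  [MetricSpace 𝔸] [NormedAddTorsor V 𝔸] [Fintype I] {D : ModelApartment V 𝔸 I}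
  {H : ApartmentSystem D X} {f h : 𝔸 → X}

variable (H) in
/-- Some chart agrees with `f` on a closed cell that contains a sector germ and the germ at `x` of
the opposite chamber, and with `h` on the germ of the opposite chamber at `x - t u`. -/
def Linked (u : V) (o x : 𝔸) (f h : 𝔸 → X) (t : ℝ) : Prop :=
  ∃ g, H.IsChart g ∧
    (∃ E, D.IsClosedCell E ∧ EqOn f g E ∧ E ∈ D.sectorGerm o 1 ∧ (0 : ℝ) • u +ᵥ x ∈ E ∧
      ∃ ε : ℝ, 0 < ε ∧ (-ε) • u +ᵥ x ∈ E) ∧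
    ∃ E, D.IsClosedCell E ∧ EqOn g h E ∧ (-t) • u +ᵥ x ∈ E ∧ ∃ ε > 0, (-t - ε) • u +ᵥ x ∈ E

theorem Linked.exists_gt {u : V} (hu : ∀ i, D.root i u = 1) (hD : D.ModeratelyImaginary)
    {o x : 𝔸} {t : ℝ} (ht : H.Linked u o x f h t) :
    ∃ ε > 0, ∀ t' ∈ Ico t (t + ε), H.Linked u o x f h t' := by
  obtain ⟨g, hg, h1, E, hE, heq, h2, ε, hε, h3⟩ := ht
  refine ⟨ε, hε, fun t' ht' => ⟨g, hg, h1, E, hE, heq, ?_, t + ε - t', by linarith [ht'.2], ?_⟩⟩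
  · exact hE.smul_vadd_mem hD hu h3 h2 (by linarith [ht'.2]) (by linarith [ht'.1])
  · convert h3 using 3
    ring

theorem smul_mem_of_sectorGerm_one (hD : D.ModeratelyImaginary) {u : V}
    (hu : ∀ i, D.root i u = 1) {o x : 𝔸} {E : Set 𝔸} (hE : D.IsClosedCell E)
    (hS : E ∈ D.sectorGerm o 1) {a b : ℝ} (ha : a • u +ᵥ x ∈ E) (hab : a ≤ b) :
    b • u +ᵥ x ∈ E :=
  hE.mem_of_mem_sectorGerm hD hu (Or.inl rfl) hS ha fun i => by
    simpa [vadd_vsub_vadd_cancel_right, hu] using hab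

theorem smul_mem_of_sectorGerm_neg_one (hD : D.ModeratelyImaginary) {u : V}
    (hu : ∀ i, D.root i u = 1) {o x : 𝔸} {E : Set 𝔸} (hE : D.IsClosedCell E)
    (hS : E ∈ D.sectorGerm o (-1)) {a b : ℝ} (ha : a • u +ᵥ x ∈ E) (hab : b ≤ a) :
    b • u +ᵥ x ∈ E :=
  hE.mem_of_mem_sectorGerm hD hu (Or.inr rfl) hS ha fun i => by
    simpa [vadd_vsub_vadd_cancel_right, hu] using hab

/-- The limit step. A chart through the chamber above `b = x - mu` is compared with the linking
chart at a parameter `t` slightly below `m`, which carries the agreement with `f` over to it. A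
chart through the chamber below `b` is then compared with that one at `b`, and it links `f` to `h`
at `m`. -/
theorem Linked.of_lt [FiniteDimensional ℝ V] (hD : D.ModeratelyImaginary)
    (hH : H.IsAffineHovel) (hO : H.IsOrdered) (hf : H.IsChart f) (hh : H.IsChart h) {u : V}
    (hu : ∀ i, D.root i u = 1) (hu0 : u ≠ 0) {o x : 𝔸} {m : ℝ} (hm : 0 < m)
    (hlt : ∀ t ∈ Ico 0 m, H.Linked u o x f h t) : H.Linked u o x f h m := by
  have hadd : ∀ a b : ℝ, a • u +ᵥ (b • u +ᵥ x) = (a + b) • u +ᵥ x := fun a b => by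
    rw [vadd_vadd, ← add_smul]
  have h1 : (1 : ℝ) = 1 ∨ (1 : ℝ) = -1 := Or.inl rfl
  have hm1 : (-1 : ℝ) = 1 ∨ (-1 : ℝ) = -1 := Or.inr rfl
  -- an apartment containing the sector germ and the chamber `b + C` of `h`, where `b = x - m u`
  obtain ⟨j₀, hj₀, hj₀S, hj₀F⟩ := hH.exists_chart_facet hf hh h1 o ((-m) • u +ᵥ x)
    (D.isVectorialFacet_chamber h1)
  obtain ⟨j, hj, hjr, Ej, hEj, hbj, ⟨εj, hεj, hbj'⟩, heqj⟩ :=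
    hH.exists_agree_chamber hh hj₀ hu hu0 h1 hj₀F
  rw [mul_one, hadd] at hbj'
  rw [← hjr] at hj₀S
  -- So close to `m`, the point `x - tu` lies in `Ej`, strictly above `b`; hence `g` and `j` both
  -- agree with `h` on a box just below `x - tu`.
  obtain ⟨t, ht, htj⟩ : ∃ t ∈ Ico 0 m, m - εj < t :=
    ⟨max 0 (m - εj / 2), ⟨le_max_left _ _, max_lt hm (by linarith)⟩,
      lt_of_lt_of_le (by linarith) (le_max_right _ _)⟩
  obtain ⟨g, hg, ⟨E, hE, heq, hES, hxE, ε, hε, hxε⟩, E', hE', heq', htE', ε', hε', htε'⟩ :=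
    hlt t ht
  have hgS : ∀ᶠ p in D.sectorGerm o 1, g p ∈ range j := by
    filter_upwards [hES, hj₀S] with p hp hpj
    rwa [← heq hp]
  have hδ : 0 < min ε' (m - t) := lt_min hε' (by linarith [ht.2])
  set δ := min ε' (m - t) with hδdef
  have hδ1 : δ ≤ ε' := min_le_left _ _
  have hδ2 : δ ≤ m - t := min_le_right _ _
  have hcell := hE'.inter hEj
  have hta : (-t) • u +ᵥ x ∈ E' ∩ Ej :=
    ⟨htE', hEj.smul_vadd_mem hD hu hbj hbj' (by linarith [ht.2]) (by linarith)⟩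
  have htb : (-t - δ) • u +ᵥ x ∈ E' ∩ Ej :=
    ⟨hE'.smul_vadd_mem hD hu htε' htE' (by linarith) (by linarith),
      hEj.smul_vadd_mem hD hu hbj hbj' (by linarith) (by linarith)⟩
  have hgj : EqOn g j (E' ∩ Ej) := fun p hp => (heq' hp.1).trans (heqj hp.2)
  obtain ⟨j', hj', hjr', E₁, hE₁, hE₁S, htE₁, ⟨ε₁, hε₁, htε₁⟩, heq₁⟩ :=
    hH.exists_agree_sector_chamber hD hg hj hu hu0 h1 hm1 hgS hcell hta hδ
      (by rw [hadd]; convert htb using 3; ring)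
      (fun p hp => by rw [hgj hp]; exact mem_range_self p)
  rw [hadd] at htε₁
  have hδ' : 0 < min δ ε₁ := lt_min hδ hε₁
  -- Both charts agree with `g` on a box with top `x - tu`, so they coincide, and `j` agrees with
  -- `g` on a cell containing the sector germ.
  have hjj : j' = j := by
    refine hj'.eq_of_eqOn_closedCell hD hj hjr'.symm hu (hE₁.inter hcell)
      (fun p hp => (heq₁ hp.1).symm.trans (hgj hp.2)) (a := (-t - min δ ε₁) • u +ᵥ x) ⟨?_, ?_⟩
      hδ' ?_
    · exact hE₁.smul_vadd_mem hD hu htε₁ htE₁ (by linarith [min_le_right δ ε₁]) (by linarith)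
    · exact hcell.smul_vadd_mem hD hu htb hta (by linarith [min_le_left δ ε₁]) (by linarith)
    · rw [hadd, add_sub_cancel]
      exact ⟨htE₁, hta⟩
  subst hjj
  -- an apartment containing the sector germ and the chamber `b - C` of `h`
  obtain ⟨k₀, hk₀, hk₀S, hk₀F⟩ := hH.exists_chart_facet hf hh h1 o ((-m) • u +ᵥ x)
    (D.isVectorialFacet_chamber hm1)
  obtain ⟨k, hk, hkr, Ek, hEk, hbk, ⟨εk, hεk, hbk'⟩, heqk⟩ :=
    hH.exists_agree_chamber hh hk₀ hu hu0 hm1 hk₀F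
  rw [hadd] at hbk'
  rw [← hkr] at hk₀S
  have hjS : ∀ᶠ p in D.sectorGerm o 1, j' p ∈ range k := by
    filter_upwards [hES, hE₁S, hk₀S] with p hp hp₁ hpk
    rwa [← heq₁ hp₁, ← heq hp]
  obtain ⟨l, hl, hlr, E₂, hE₂, hE₂S, hbE₂, heq₂⟩ :=
    hH.exists_agree_sector_point hD hj hk h1 hjS (x := (-m) • u +ᵥ x) (by
      rw [← heqj hbj, heqk hbk]
      exact mem_range_self _)
  -- On a box above `b`, `l` agrees with `j`, hence with `h`. The points of this box then belong to
  -- the apartment of `k`, and since `k` agrees with `h` below `b`, `eq_of_dominant` gives agreement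
  -- of `k` with `h` there too.
  have hlk : k = l := by
    refine hk.eq_of_eq_on_box hl hlr hu ((-m) • u +ᵥ x) hεj fun p hp0 hp1 => ?_
    have hpj : p ∈ Ej := hEj.mem_of_between hD hbj hbj' hp0 fun i => by
      rw [← hadd, vadd_vsub_assoc, ← neg_vsub_eq_vsub_rev p, map_add, map_neg, map_smul, hu,
        smul_eq_mul]
      linarith [hp1 i]
    have hp₂ : p ∈ E₂ := hE₂.mem_of_mem_sectorGerm hD hu h1 hE₂S hbE₂ fun i => by
      simpa using hp0 i
    have hhl : h p = l p := (heqj hpj).trans (heq₂ hp₂)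
    have := eq_of_dominant hD hH hO hh hk hu hEk heqk hbk' hεk
      (by rw [hadd]; convert hbk using 3; ring) (q := p) (fun i => by
        have := hp0 i
        rw [← vsub_add_vsub_cancel p ((-m) • u +ᵥ x), vadd_vsub_vadd_cancel_right, ← sub_smul,
          map_add, map_smul, hu, smul_eq_mul]
        linarith) (by rw [hhl, ← hlr]; exact mem_range_self p)
    rw [← this, hhl]
  subst hlk
  -- The cell `E₂` is known to reach below `x` only as far as `b = x - mu`, whence the `m` in the
  -- minimum.
  refine ⟨k, hk, ⟨E ∩ E₁ ∩ E₂, (hE.inter hE₁).inter hE₂, fun p hp => ?_, ?_, ⟨⟨hxE, ?_⟩, ?_⟩,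
    min ε (min ε₁ m), lt_min hε (lt_min hε₁ hm), ⟨⟨?_, ?_⟩, ?_⟩⟩, Ek, hEk, ?_, hbk, εk, hεk, ?_⟩
  · exact ((heq hp.1.1).trans (heq₁ hp.1.2)).trans (heq₂ hp.2)
  · exact inter_mem (inter_mem hES hE₁S) hE₂S
  · exact smul_mem_of_sectorGerm_one hD hu hE₁ hE₁S htE₁ (by linarith [ht.1])
  · exact smul_mem_of_sectorGerm_one hD hu hE₂ hE₂S hbE₂ (by linarith)
  · exact hE.smul_vadd_mem hD hu hxε hxE (by linarith [min_le_left ε (min ε₁ m)])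
      (by linarith [lt_min hε (lt_min hε₁ hm)])
  · refine smul_mem_of_sectorGerm_one hD hu hE₁ hE₁S htε₁ ?_
    linarith [ht.1, min_le_right ε (min ε₁ m), min_le_left ε₁ m]
  · refine smul_mem_of_sectorGerm_one hD hu hE₂ hE₂S hbE₂ ?_
    linarith [min_le_right ε (min ε₁ m), min_le_right ε₁ m]
  · exact fun p hp => (heqk hp).symm
  · convert hbk' using 3
    ring

theorem linked_of_nonneg [FiniteDimensional ℝ V] (hD : D.ModeratelyImaginary)
    (hH : H.IsAffineHovel) (hO : H.IsOrdered) (hf : H.IsChart f) (hh : H.IsChart h) {u : V}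
    (hu : ∀ i, D.root i u = 1) (hu0 : u ≠ 0) {o x : 𝔸} (h0 : H.Linked u o x f h 0) {t : ℝ}
    (ht : 0 ≤ t) : H.Linked u o x f h t := by
  by_contra hnot
  -- Continuous induction: the infimum of the failures is linked by `Linked.of_lt`, and then so is
  -- an interval to its right.
  set S := {t : ℝ | 0 ≤ t ∧ ¬ H.Linked u o x f h t} with hS
  have hne : S.Nonempty := ⟨t, ht, hnot⟩
  have hbdd : BddBelow S := ⟨0, fun s hs => hs.1⟩
  have hm0 : 0 ≤ sInf S := le_csInf hne fun s hs => hs.1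
  have hlt : ∀ s ∈ Ico 0 (sInf S), H.Linked u o x f h s := fun s hs => by
    by_contra hn
    exact absurd (csInf_le hbdd (show s ∈ S from ⟨hs.1, hn⟩)) (not_le.2 hs.2)
  have hm : H.Linked u o x f h (sInf S) := by
    rcases eq_or_lt_of_le hm0 with h | h
    · rwa [← h]
    · exact Linked.of_lt hD hH hO hf hh hu hu0 h hlt
  obtain ⟨ε, hε, hgt⟩ := hm.exists_gt hu hD
  obtain ⟨s, hs, hsε⟩ := exists_lt_of_csInf_lt hne (lt_add_of_pos_right (sInf S) hε)
  exact hs.2 (hgt s ⟨csInf_le hbdd hs, hsε⟩)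

/-- If two apartments share the germ at `x` of the chamber `x - C`, then there is an apartment that
contains the sector germ of direction `C` of the first one and the sector germ of direction `-C` of
the second one, as well as the germ at `x`. -/
theorem exists_chart_opposite_sectors [FiniteDimensional ℝ V] (hD : D.ModeratelyImaginary)
    (hH : H.IsAffineHovel) (hO : H.IsOrdered) (hf : H.IsChart f) (hh : H.IsChart h) {u : V}
    (hu : ∀ i, D.root i u = 1) (hu0 : u ≠ 0) (o : 𝔸) {x : 𝔸} {E₀ : Set 𝔸}
    (hE₀ : D.IsClosedCell E₀) (hfh : EqOn f h E₀) (hx : x ∈ E₀) {ε₀ : ℝ} (hε₀ : 0 < ε₀)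
    (hxε : (-ε₀) • u +ᵥ x ∈ E₀) :
    ∃ g, H.IsChart g ∧
      (∃ E, D.IsClosedCell E ∧ EqOn f g E ∧ E ∈ D.sectorGerm o 1 ∧ x ∈ E) ∧
      ∃ E, D.IsClosedCell E ∧ EqOn h g E ∧ E ∈ D.sectorGerm o (-1) ∧ x ∈ E := by
  have hadd : ∀ a b : ℝ, a • u +ᵥ (b • u +ᵥ x) = (a + b) • u +ᵥ x := fun a b => by
    rw [vadd_vadd, ← add_smul]
  have hx0 : (0 : ℝ) • u +ᵥ x = x := by rw [zero_smul, zero_vadd]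
  have h1 : (1 : ℝ) = 1 ∨ (1 : ℝ) = -1 := Or.inl rfl
  have hm1 : (-1 : ℝ) = 1 ∨ (-1 : ℝ) = -1 := Or.inr rfl
  obtain ⟨k, hk, hkf, hkh⟩ := hH.exists_chart_sector hf hh hu h1 hm1 o
  have hray : ∀ᶠ t : ℝ in atTop, h ((t * -1) • u +ᵥ x) ∈ range k :=
    D.eventually_mem_of_mem_sectorGerm hu hm1 hkh x
  -- From parameter `t` on, the whole ray `x - su` of `h` lies in the apartment of `k`, so a chart
  -- linked at `t` shares with `k` an interval germ below `x - tu`.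
  obtain ⟨t, ht0, ht⟩ :=
    ((eventually_ge_atTop (0 : ℝ)).and (eventually_forall_ge_atTop.2 hray)).exists
  have hstart : H.Linked u o x f h 0 :=
    ⟨f, hf, ⟨univ, D.isClosedCell_univ, fun _ _ => rfl, univ_mem, trivial, 1, one_pos, trivial⟩,
      E₀, hE₀, hfh, by rwa [neg_zero, hx0], ε₀, hε₀, by rwa [neg_zero, zero_sub]⟩
  obtain ⟨l, hl, ⟨E, hE, heq, hES, hxE, ε, hε, -⟩, E', hE', heq', htE', ε', hε', htε'⟩ :=
    linked_of_nonneg hD hH hO hf hh hu hu0 hstart ht0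
  have hne : (-t) • u +ᵥ x ≠ (-t - ε') • u +ᵥ x := fun heq => by
    have := smul_left_injective ℝ hu0 (vadd_right_cancel x heq)
    linarith
  have hle : D.Le ((-t - ε') • u +ᵥ x) ((-t) • u +ᵥ x) :=
    D.mem_titsCone_of_nonneg fun i => by
      simpa [vadd_vsub_vadd_cancel_right, hu] using hε'.le
  obtain ⟨k₁, -, hkr₁, E₁, hE₁, htE₁, ⟨r, hr, htr⟩, heq₁⟩ :=
    hH.exists_agree_segment hl hk hne (Or.inr hle) (by
      filter_upwards [self_mem_nhdsWithin] with p hp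
      obtain ⟨⟨r, hr, rfl⟩, -⟩ := hp
      rw [heq' (hE'.lineMap_mem htE' htε' hr), ModelApartment.lineMap_smul_vadd]
      have := ht (t + r * ε') (by nlinarith [hr.1])
      convert this using 4
      ring)
  rw [ModelApartment.lineMap_smul_vadd] at htr
  have hlS : ∀ᶠ p in D.sectorGerm o 1, l p ∈ range k := by
    filter_upwards [hES, hkf] with p hp hpk
    rwa [← heq hp]
  obtain ⟨g, hg, hgr, E₂, hE₂, hE₂S, htE₂, ⟨ε₂, hε₂, htε₂⟩, heq₂⟩ :=
    hH.exists_agree_sector_chamber hD hl hk hu hu0 h1 hm1 hlS hE₁ htE₁ (mul_pos hr.1 hε')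
      (by rw [hadd]; convert htr using 3; ring)
      (fun p hp => by rw [heq₁ hp, ← hkr₁]; exact mem_range_self p)
  rw [hadd] at htε₂
  have hxE₂ : x ∈ E₂ := by
    rw [← hx0]
    exact smul_mem_of_sectorGerm_one hD hu hE₂ hE₂S htE₂ (by linarith)
  rw [hx0] at hxE
  have hgx : h x = g x := by rw [← hfh hx, heq hxE, heq₂ hxE₂]
  rw [← hgr] at hkh
  obtain ⟨g', hg', hgr', E₃, hE₃, hE₃S, hxE₃, heq₃⟩ :=
    hH.exists_agree_sector_point hD hh hg hm1 hkh (x := x) (by rw [hgx]; exact mem_range_self x)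
  -- On a box with top `x - tu`, the agreements of `g'` with `h`, of `h` with `l` and of `l` with
  -- `g` combine. The cell `E₃` reaches that far down because it contains `x` and the sector germ of
  -- direction `-C`.
  have hgg : g' = g := by
    have hcell := (hE'.inter hE₂)
    have hδ : 0 < min ε' ε₂ := lt_min hε' hε₂
    refine hg'.eq_of_eqOn_closedCell hD hg hgr'.symm hu (hE₃.inter hcell)
      (fun p hp => ((heq₃ hp.1).symm.trans (heq' hp.2.1).symm).trans (heq₂ hp.2.2))
      (a := (-t - min ε' ε₂) • u +ᵥ x) ⟨?_, ?_, ?_⟩ hδ ?_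
    · rw [← hx0] at hxE₃
      exact smul_mem_of_sectorGerm_neg_one hD hu hE₃ hE₃S hxE₃ (by linarith)
    · exact hE'.smul_vadd_mem hD hu htε' htE' (by linarith [min_le_left ε' ε₂]) (by linarith)
    · exact hE₂.smul_vadd_mem hD hu htε₂ htE₂ (by linarith [min_le_right ε' ε₂]) (by linarith)
    · rw [hadd, add_sub_cancel]
      rw [← hx0] at hxE₃
      exact ⟨smul_mem_of_sectorGerm_neg_one hD hu hE₃ hE₃S hxE₃ (by linarith), htE', htE₂⟩
  subst hgg
  exact ⟨g', hg, ⟨E ∩ E₂, hE.inter hE₂, fun p hp => (heq hp.1).trans (heq₂ hp.2),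
    inter_mem hES hE₂S, hxE, hxE₂⟩, E₃, hE₃, heq₃, hE₃S, hxE₃⟩

/-- Two apartments that share the germ at `x` of the chamber `x - C` and a point `y` of `x + C̄` are
related by an isomorphism that fixes the enclosure of `{x, y}`. -/
theorem exists_closedCell_of_opposite [FiniteDimensional ℝ V] (hD : D.ModeratelyImaginary)
    (hH : H.IsAffineHovel) (hO : H.IsOrdered) (hf : H.IsChart f) (hh : H.IsChart h) {u : V}
    (hu : ∀ i, D.root i u = 1) (hu0 : u ≠ 0) {x y : 𝔸} {E₀ : Set 𝔸}
    (hE₀ : D.IsClosedCell E₀) (hfh : EqOn f h E₀) (hx : x ∈ E₀) {ε₀ : ℝ} (hε₀ : 0 < ε₀)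
    (hxε : (-ε₀) • u +ᵥ x ∈ E₀) (hxy : ∀ i, 0 ≤ D.root i (y -ᵥ x)) (hy : f y = h y) :
    ∃ E, D.IsClosedCell E ∧ x ∈ E ∧ y ∈ E ∧ EqOn f h E := by
  have hm1 : (-1 : ℝ) = 1 ∨ (-1 : ℝ) = -1 := Or.inr rfl
  obtain ⟨g, hg, ⟨E, hE, heq, hES, hxE⟩, E', hE', heq', hES', hxE'⟩ :=
    exists_chart_opposite_sectors hD hH hO hf hh hu hu0 x hE₀ hfh hx hε₀ hxε
  have hyE : y ∈ E := hE.mem_of_mem_sectorGerm hD hu (Or.inl rfl) hES hxE fun i => by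
    simpa using hxy i
  obtain ⟨g', hg', hgr', E₂, hE₂, hES₂, hyE₂, heq₂⟩ :=
    hH.exists_agree_sector_point hD hh hg hm1
      (by filter_upwards [hES'] with p hp; rw [heq' hp]; exact mem_range_self p)
      (x := y) (by rw [← hy, heq hyE]; exact mem_range_self y)
  -- The point `x` lies in the closed sector of direction `-C` with apex `y`, just as `y` lies in
  -- the one of direction `C` with apex `x`; both cells therefore contain both points.
  have hxE₂ : x ∈ E₂ := hE₂.mem_of_mem_sectorGerm hD hu hm1 hES₂ hyE₂ fun i => by
    rw [← neg_vsub_eq_vsub_rev, map_neg]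
    simpa using hxy i
  have hgg : g' = g := by
    have key : ∀ F, D.IsClosedCell F → F ∈ D.sectorGerm x (-1) → x ∈ F →
        (-1 : ℝ) • u +ᵥ x ∈ F := fun F hF hFS hxF =>
      hF.mem_of_mem_sectorGerm hD hu hm1 hFS hxF fun i => by simp [hu]
    refine hg'.eq_of_eqOn_closedCell hD hg hgr'.symm hu (hE'.inter hE₂)
      (fun p hp => (heq₂ hp.2).symm.trans (heq' hp.1)) (a := (-1 : ℝ) • u +ᵥ x)
      ⟨key E' hE' hES' hxE', key E₂ hE₂ hES₂ hxE₂⟩ one_pos ?_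
    rw [vadd_vadd, ← add_smul, add_neg_cancel, zero_smul, zero_vadd]
    exact ⟨hxE', hxE₂⟩
  subst hgg
  exact ⟨E ∩ E₂, hE.inter hE₂, ⟨hxE, hxE₂⟩, ⟨hyE, hyE₂⟩,
    fun p hp => (heq hp.1).trans (heq₂ hp.2).symm⟩

/-! ### Isomorphisms fixing the enclosure of a preordered segment. -/

/-- The auxiliary apartment `b` shares with `f` a sector of direction `C` at `x`, and with the
second apartment the germ at `x` in direction `-C`. The first sharing gives a cell through `x` and
`y` by (MA4), the second by `exists_closedCell_of_opposite`. -/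
theorem exists_agree_of_dominant [FiniteDimensional ℝ V] (hD : D.ModeratelyImaginary)
    (hH : H.IsAffineHovel) (hO : H.IsOrdered) (hf : H.IsChart f) (hh : H.IsChart h) {u : V}
    (hu : ∀ i, D.root i u = 1) (hu0 : u ≠ 0) {x y : 𝔸} (hne : x ≠ y)
    (hxy : ∀ i, 0 ≤ D.root i (y -ᵥ x)) (hx : f x ∈ range h) (hy : f y ∈ range h) :
    ∃ k, H.IsChart k ∧ range k = range h ∧
      ∃ E, D.IsClosedCell E ∧ x ∈ E ∧ y ∈ E ∧ EqOn f k E := by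
  have h1 : (1 : ℝ) = 1 ∨ (1 : ℝ) = -1 := Or.inl rfl
  have hm1 : (-1 : ℝ) = 1 ∨ (-1 : ℝ) = -1 := Or.inr rfl
  have hle : D.Le x y := D.mem_titsCone_of_nonneg hxy
  obtain ⟨x', hx'⟩ := hx
  obtain ⟨y', hy'⟩ := hy
  have hseg := hO.image_segment_eq hf hh hle hx'.symm hy'.symm
  -- a chart of the second apartment that agrees with `f` on `[x, y]`
  obtain ⟨k, hk, hkr, E, hE, hxE, ⟨ε, hε, hεE⟩, heq⟩ :=
    hH.exists_agree_segment hf hh hne (Or.inl hle) (by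
      filter_upwards [self_mem_nhdsWithin] with p hp
      have : f p ∈ f '' affineSegment ℝ x y := mem_image_of_mem f hp.1
      rw [hseg] at this
      exact image_subset_range _ _ this)
  have hky : f y = k y := by
    have := eq_on_segment hH hO hf hk hle (heq hxE) ⟨ε, hε, heq hεE⟩
      (by rw [hkr, ← hy']; exact mem_range_self y') 1 (right_mem_Icc.2 zero_le_one)
    simpa using this
  -- an apartment that contains the sector germ of `f` and the chamber `x - C` of `k`
  obtain ⟨b, hb, hbf, hbk⟩ := hH.exists_chart_facet hf hk h1 x x (D.isVectorialFacet_chamber hm1)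
  obtain ⟨l, hl, hlr, E₁, hE₁, hxE₁, ⟨ε₁, hε₁, hxε₁⟩, heq₁⟩ :=
    hH.exists_agree_chamber hk hb hu hu0 hm1 hbk
  obtain ⟨g, hg, hgr, E₂, hE₂, hES₂, hxE₂, heq₂⟩ :=
    hH.exists_agree_sector_point hD hf hb h1 hbf (x := x)
      (by rw [heq hxE, heq₁ hxE₁, ← hlr]; exact mem_range_self x)
  have hyE₂ : y ∈ E₂ := hE₂.mem_of_mem_sectorGerm hD hu h1 hES₂ hxE₂ fun i => by
    simpa using hxy i
  rw [mul_neg_one] at hxε₁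
  -- The charts `k` and `l` agree on a box from `x - ε₁u` to `x`, and `y` is above its lower corner;
  -- `y` is in both apartments because `k y = f y = g y`.
  have hkl : k y = l y := by
    refine eq_of_dominant hD hH hO hk hl hu hE₁ heq₁ hxε₁ hε₁ ?_ (fun i => ?_) ?_
    · rw [vadd_vadd, ← add_smul, add_neg_cancel, zero_smul, zero_vadd]
      exact hxE₁
    · rw [vsub_vadd_eq_vsub_sub, map_sub, map_smul, hu, smul_eq_mul]
      linarith [hxy i]
    · rw [← hky, heq₂ hyE₂, hlr, ← hgr]
      exact mem_range_self y
  obtain ⟨E₃, hE₃, hxE₃, hyE₃, heq₃⟩ := exists_closedCell_of_opposite hD hH hO hk hl hu hu0 hE₁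
    heq₁ hxE₁ hε₁ hxε₁ hxy hkl
  -- `g` and `l` are charts of the same apartment but need not coincide: they differ by an element
  -- of `W` that fixes `x` and `y`. Correcting `k` by it makes the two agreements composable.
  obtain ⟨w, hw, rfl⟩ := hl.exists_weyl hg (hgr.trans hlr.symm)
  have hwx : w x = x := hl.injective ((heq₂ hxE₂).symm.trans ((heq hxE).trans (heq₁ hxE₁)))
  have hwy : w y = y := hl.injective ((heq₂ hyE₂).symm.trans (hky.trans hkl))
  refine ⟨k ∘ w, hk.comp_weyl hw, (IsChart.range_comp_equiv w).trans hkr, E₂ ∩ w ⁻¹' E₃,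
    hE₂.inter (hE₃.preimage hw), ⟨hxE₂, ?_⟩, ⟨hyE₂, ?_⟩, fun p hp => ?_⟩
  · rwa [mem_preimage, hwx]
  · rwa [mem_preimage, hwy]
  · rw [heq₂ hp.1, Function.comp_apply, Function.comp_apply, heq₃ hp.2]

/-- If `x ≤ y` in an apartment and both points are in another one, some isomorphism between the two
apartments fixes the enclosure of `[x, y]`. -/
theorem exists_agree_of_le [FiniteDimensional ℝ V] (hD : D.ModeratelyImaginary)
    (hH : H.IsAffineHovel) (hO : H.IsOrdered) (hf : H.IsChart f) (hh : H.IsChart h)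
    {p q : 𝔸} (hne : p ≠ q) (hle : D.Le p q) (hp : f p ∈ range h) (hq : f q ∈ range h) :
    ∃ k, H.IsChart k ∧ range k = range h ∧
      ∃ E, D.IsClosedCell E ∧ p ∈ E ∧ q ∈ E ∧ EqOn f k E := by
  have : Nontrivial V := ⟨⟨q -ᵥ p, 0, fun h => hne (vsub_eq_zero_iff_eq.1 h).symm⟩⟩
  obtain ⟨u, hu0, hu⟩ := D.exists_root_eq_one
  obtain ⟨v, hv, v₀, hv₀, hqp⟩ := D.exists_dominant_of_mem_titsCone hle
  obtain ⟨w, hw, rfl⟩ := D.exists_linear_eq hv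
  have hwp : w (w.symm p) = p := w.apply_symm_apply p
  have hwq : w (w.symm q) = q := w.apply_symm_apply q
  obtain ⟨k, hk, hkr, E, hE, hpE, hqE, heq⟩ := exists_agree_of_dominant hD hH hO
    (hf.comp_weyl hw) hh hu hu0 (x := w.symm p) (y := w.symm q)
    (fun h => hne (w.symm.injective h)) (fun i => by
      have : w.symm q -ᵥ w.symm p = v₀ := by
        refine w.linear.injective ?_
        rw [← hqp]
        have := w.toAffineMap.linearMap_vsub (w.symm q) (w.symm p)
        simpa using this
      rw [this]
      exact hv₀ i) (by rwa [Function.comp_apply, hwp]) (by rwa [Function.comp_apply, hwq])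
  have hw' : w.symm ∈ D.weyl := inv_mem hw
  refine ⟨k ∘ w.symm, hk.comp_weyl hw', (IsChart.range_comp_equiv _).trans hkr, w.symm ⁻¹' E,
    hE.preimage hw', hpE, hqE, fun a ha => ?_⟩
  have := heq ha
  rwa [Function.comp_apply, w.apply_symm_apply] at this

/-- Two charts that agree on a closed cell containing `p` and `q` yield an isomorphism that fixes
the enclosure of the segment. -/
theorem exists_iso_of_eqOn {A A' : Set X} (hA : A ∈ H.apartments) {e : 𝔸 ≃ A}
    (he : e ∈ H.isom A) {e' : 𝔸 ≃ A'} (he' : e' ∈ H.isom A') {E : Set 𝔸}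
    (hE : D.IsClosedCell E) {p q : 𝔸} (hp : p ∈ E) (hq : q ∈ E)
    (heq : ∀ a ∈ E, (e a : X) = e' a) :
    ∃ φ : A ≃ A', H.IsIso A A' φ ∧ Fixes φ (H.enclosure A (𝓟 (H.segmentIn A (e p) (e q)))) := by
  refine ⟨e.symm.trans e', ⟨e, he, ?_⟩, ?_⟩
  · rw [← Equiv.trans_assoc, Equiv.self_trans_symm, Equiv.refl_trans]
    exact he'
  have hc : H.IsChart fun a => (e a : X) := ⟨A, hA, e, he, rfl⟩
  have hseg : H.segmentIn A (e p) (e q) = (fun a => (e a : X)) '' affineSegment ℝ p q := by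
    have := hc.segmentIn_eq p q
    rwa [range_isom] at this
  -- The enclosure in `A` is a supremum over all charts of `A`; for the chart `e ∘ w` the cell to
  -- use is the preimage of `E` under `w`.
  refine mem_iSup.2 fun e₁ => mem_iSup.2 fun he₁ => ?_
  obtain ⟨w, hw, rfl⟩ := (H.mem_isom_iff A hA e he e₁).1 he₁
  refine ⟨w ⁻¹' E, ?_, hE.preimage hw, fun a ha => ?_⟩
  · rw [comap_principal, mem_principal, hseg]
    rintro a ⟨b, ⟨t, ht, rfl⟩, hb⟩
    have hb' : AffineMap.lineMap p q t = w a := hc.injective hb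
    rw [mem_preimage, ← hb']
    exact hE.lineMap_mem hp hq ht
  · refine ⟨(e (w a)).2, ?_⟩
    change ((e' (e.symm (e (w a))) : A') : X) = e (w a)
    rw [Equiv.symm_apply_apply]
    exact (heq _ ha).symm

end ApartmentSystem

end Hovel

/-! ### Transfer of the two preorders between apartments. -/

namespace Hovel

namespace ApartmentSystem

variable {V 𝔸 I X : Type*} [NormedAddCommGroup V] [NormedSpace ℝ V] [FiniteDimensional ℝ V]
  [MetricSpace 𝔸] [NormedAddTorsor V 𝔸] [Fintype I] {D : ModelApartment V 𝔸 I}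
  {H : ApartmentSystem D X}

/-- The chart `e'` represents the two points by the same `p` and `q` as `e`, so any relation between
`p` and `q` passes to `A'`; this serves both preorders. -/
theorem exists_iso_of_le (hD : D.ModeratelyImaginary) (hH : H.IsAffineHovel) (hO : H.IsOrdered)
    {A A' : Set X} (hA : A ∈ H.apartments) (hA' : A' ∈ H.apartments) {e : 𝔸 ≃ A}
    (he : e ∈ H.isom A) {p q : 𝔸} (hne : (e p : X) ≠ e q) (hle : D.Le p q)
    (hp : (e p : X) ∈ A') (hq : (e q : X) ∈ A') :
    (∃ e' ∈ H.isom A', (e' p : X) = e p ∧ (e' q : X) = e q) ∧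
      ∃ φ : A ≃ A', H.IsIso A A' φ ∧
        Fixes φ (H.enclosure A (𝓟 (H.segmentIn A (e p) (e q)))) := by
  obtain ⟨e₀, he₀⟩ := H.isom_nonempty A' hA'
  obtain ⟨k, hk, hkr, E, hE, hpE, hqE, heq⟩ := exists_agree_of_le hD hH hO
    (f := fun a => (e a : X)) (h := fun a => (e₀ a : X)) ⟨A, hA, e, he, rfl⟩
    ⟨A', hA', e₀, he₀, rfl⟩ (fun h => hne (by rw [h])) hle
    (by rwa [range_isom]) (by rwa [range_isom])
  rw [range_isom] at hkr
  subst hkr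
  obtain ⟨e', he', hke⟩ := hk.exists_isom
  have heq' : ∀ a ∈ E, (e a : X) = e' a := fun a ha => (heq ha).trans (congrFun hke a)
  exact ⟨⟨e', he', (heq' p hpE).symm, (heq' q hqE).symm⟩,
    exists_iso_of_eqOn hA he he' hE hpE hqE heq'⟩

theorem leIn_and_exists_iso (hD : D.ModeratelyImaginary) (hH : H.IsAffineHovel)
    (hO : H.IsOrdered) {A A' : Set X} (hA : A ∈ H.apartments) (hA' : A' ∈ H.apartments) {x y : X}
    (hx : x ∈ A') (hy : y ∈ A') (hne : x ≠ y) (h : H.LeIn A x y) :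
    H.LeIn A' x y ∧ ∃ φ : A ≃ A', H.IsIso A A' φ ∧
      Fixes φ (H.enclosure A (𝓟 (H.segmentIn A x y))) := by
  obtain ⟨e, he, p, q, rfl, rfl, hle⟩ := h
  obtain ⟨⟨e', he', h1, h2⟩, hφ⟩ := exists_iso_of_le hD hH hO hA hA' he hne hle hx hy
  exact ⟨⟨e', he', p, q, h1, h2, hle⟩, hφ⟩

theorem openLeIn_and_exists_iso (hD : D.ModeratelyImaginary) (hH : H.IsAffineHovel)
    (hO : H.IsOrdered) {A A' : Set X} (hA : A ∈ H.apartments) (hA' : A' ∈ H.apartments) {x y : X}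
    (hx : x ∈ A') (hy : y ∈ A') (hne : x ≠ y) (h : H.OpenLeIn A x y) :
    H.OpenLeIn A' x y ∧ ∃ φ : A ≃ A', H.IsIso A A' φ ∧
      Fixes φ (H.enclosure A (𝓟 (H.segmentIn A x y))) := by
  obtain ⟨e, he, p, q, rfl, rfl, hle⟩ := h
  -- The alternative `q - p = 0` is excluded because the two points are distinct.
  have hle' : D.Le p q := hle.elim (fun h => interior_subset h)
    fun h => absurd (by rw [vsub_eq_zero_iff_eq.1 h]) hne
  obtain ⟨⟨e', he', h1, h2⟩, hφ⟩ := exists_iso_of_le hD hH hO hA hA' he hne hle' hx hy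
  exact ⟨⟨e', he', p, q, h1, h2, hle⟩, hφ⟩

end ApartmentSystem

end Hovel

open Hovel in
theorem proposition5p4 {V 𝔸 I X : Type*} [NormedAddCommGroup V] [NormedSpace ℝ V]
    [FiniteDimensional ℝ V] [MetricSpace 𝔸] [NormedAddTorsor V 𝔸] [Fintype I]
    (D : ModelApartment V 𝔸 I) (hD : D.ModeratelyImaginary)
    (H : ApartmentSystem D X) (hH : H.IsAffineHovel) (hO : H.IsOrdered) :
    (∀ A₁ ∈ H.apartments, ∀ A₂ ∈ H.apartments, ∀ x ∈ A₁ ∩ A₂, ∀ y ∈ A₁ ∩ A₂, x ≠ y →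
      (H.LeIn A₁ x y → H.LeIn A₂ x y ∧ ∃ φ : A₁ ≃ A₂, H.IsIso A₁ A₂ φ ∧
        ApartmentSystem.Fixes φ (H.enclosure A₁ (Filter.principal (H.segmentIn A₁ x y)))) ∧
      (H.OpenLeIn A₁ x y → H.OpenLeIn A₂ x y ∧ ∃ φ : A₁ ≃ A₂, H.IsIso A₁ A₂ φ ∧
        ApartmentSystem.Fixes φ (H.enclosure A₁ (Filter.principal (H.segmentIn A₁ x y))))) ∧
    (∀ A ∈ H.apartments, ∀ x ∈ A, ∀ y ∈ A,
      (H.Le x y ↔ H.LeIn A x y) ∧ (H.OpenLe x y ↔ H.OpenLeIn A x y)) := by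
  refine ⟨fun A₁ hA₁ A₂ hA₂ x hx y hy hne =>
    ⟨ApartmentSystem.leIn_and_exists_iso hD hH hO hA₁ hA₂ hx.2 hy.2 hne,
      ApartmentSystem.openLeIn_and_exists_iso hD hH hO hA₁ hA₂ hx.2 hy.2 hne⟩,
    fun A hA x hx y hy => ?_⟩
  rcases eq_or_ne x y with rfl | hne
  · obtain ⟨e, he⟩ := H.isom_nonempty A hA
    have h1 : (e (e.symm ⟨x, hx⟩) : X) = x := by simp
    have hle : H.LeIn A x x := ⟨e, he, _, _, h1, h1, D.mem_titsCone_of_nonneg (by simp)⟩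
    have hlt : H.OpenLeIn A x x := ⟨e, he, _, _, h1, h1, Or.inr (by simp)⟩
    exact ⟨⟨fun _ => hle, fun h => ⟨A, hA, h⟩⟩, ⟨fun _ => hlt, fun h => ⟨A, hA, h⟩⟩⟩
  · refine ⟨⟨?_, fun h => ⟨A, hA, h⟩⟩, ⟨?_, fun h => ⟨A, hA, h⟩⟩⟩
    · rintro ⟨A', hA', h⟩
      exact (ApartmentSystem.leIn_and_exists_iso hD hH hO hA' hA hx hy hne h).1
    · rintro ⟨A', hA', h⟩
      exact (ApartmentSystem.openLeIn_and_exists_iso hD hH hO hA' hA hx hy hne h).1
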